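/- An instance of polyline bundle simplification consists of a set $B=\{b_1,\dots,b_n\}$ of $n$ distinct points (bends) in the Euclidean plane, polylines $L_1,\dots,L_\ell$ with $\ell\ge 1$, each given as a nonempty list of points of $B$ in which every point occurs at most once, and a threshold $\delta\ge 0$. For $S\subseteq B$, the simplification $S_i$ of $L_i$ induced by $S$ is the list of the points of $L_i$ that lie in $S$, in the order of $L_i$ (so a bend is either kept in all polylines that contain it or dropped from all of them). We call $S$ an $\varepsilon$-simplification if for every $i$ the list $S_i$ contains the first and the last point of $L_i$ and, for any two consecutive points $a,b$ of $S_i$, the segment $(a,b)$ has Fréchet distance at most $\varepsilon$ to the part $L_i[a,\dots,b]$ of $L_i$ from $a$ to $b$. Let $\mathrm{OPT}$ be the minimum cardinality of a $\delta$-simplification. **Theorem.** There are an algorithm and constants $C,K$ such that, on every instance, the algorithm halts after at most $C\,\ell\,n^3$ steps and outputs a $2\delta$-simplification $S\subseteq B$ with $$|S|\;\le\; K\,\log(\ell+n)\cdot \mathrm{OPT}.$$ Here an algorithm is a program for the real RAM: a fixed finite program over a memory of natural-number cells and real-number cells with indirect addressing, in which each memory access, each addition, subtraction or comparison of natural numbers,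 and each addition, subtraction, multiplication, division or comparison of real numbers takes one step. The input consists of $n$, $\ell$, the coordinates of the bends, $\delta$, and the polylines as lists of indices of bends, stored one after the other together with their starting positions; the output is the characteristic vector of $S$. -/

import Mathlib

noncomputable section

/-! ## Polylines in the plane and the Fréchet distance -/

/-- The Euclidean plane. -/
abbrev Plane : Type := EuclideanSpace ℝ (Fin 2)

/-- The piecewise linear curve of the polyline with vertices `L 0, L 1, …, L (|L| - 1)`, parametrised
by the real interval `[0, |L| - 1]`. -/
def polylineCurve (L : List Plane) (x : ℝ) : Plane :=
  ((⌊x⌋₊ : ℝ) + 1 - x) • L.getD ⌊x⌋₊ 0 + (x - (⌊x⌋₊ : ℝ)) • L.getD ⌈x⌉₊ 0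

/-- `α` is a continuous non-decreasing map from `[0, 1]` onto the parameter interval
`[0, |L| - 1]` of the polyline `L`. -/
def IsReparam (L : List Plane) (α : ℝ → ℝ) : Prop :=
  ContinuousOn α (Set.Icc 0 1) ∧ MonotoneOn α (Set.Icc 0 1) ∧ α 0 = 0 ∧ α 1 = (L.length : ℝ) - 1

/-- The Fréchet distance of two (nonempty) polylines: the infimum over all pairs of
reparametrisations of the maximum distance of simultaneously visited points. -/
def frechetDist (L₁ L₂ : List Plane) : ℝ :=
  sInf {r : ℝ | ∃ α β : ℝ → ℝ, IsReparam L₁ α ∧ IsReparam L₂ β ∧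
    IsGreatest ((fun t => dist (polylineCurve L₁ (α t)) (polylineCurve L₂ (β t))) '' Set.Icc 0 1) r}

/-! ## Polyline bundle simplification -/

/-- An instance of polyline bundle simplification: `n` distinct points (bends) in the plane,
`ℓ ≥ 1` polylines, each of them a nonempty list of bends without repetition, and a threshold `δ`. -/
structure PBSInstance where
  n : ℕ
  ℓ : ℕ
  bend : Fin n → Plane
  bend_injective : Function.Injective bend
  line : Fin ℓ → List (Fin n)
  line_ne_nil : ∀ i, line i ≠ []
  line_nodup : ∀ i, (line i).Nodup
  δ : ℝ
  ℓ_pos : 0 < ℓ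
  δ_nonneg : 0 ≤ δ

/-- The part `L[a, …, b]` of a repetition-free list `L` from its member `a` to its later
member `b`, both included. -/
def subPolyline {α : Type*} [DecidableEq α] (L : List α) (a b : α) : List α :=
  (L.drop (L.idxOf a)).take (L.idxOf b + 1 - L.idxOf a)

namespace PBSInstance

variable (I : PBSInstance)

/-- The simplification of the `i`-th polyline induced by a set `S` of retained bends: the bends of
the polyline that lie in `S`, in their order along the polyline. -/
def induced (S : Finset (Fin I.n)) (i : Fin I.ℓ) : List (Fin I.n) :=
  (I.line i).filter (fun v => v ∈ S)

/-- Retaining exactly the bends in `S` is a (consistent) simplification of the bundle with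
segment-wise Fréchet error at most `ε`: every induced polyline keeps both end points of the original
polyline, and every segment `(a, b)` of it has Fréchet distance at most `ε` to the part of the
original polyline from `a` to `b`. -/
def IsSimplification (ε : ℝ) (S : Finset (Fin I.n)) : Prop :=
  ∀ i : Fin I.ℓ,
    (I.line i).head (I.line_ne_nil i) ∈ I.induced S i ∧
    (I.line i).getLast (I.line_ne_nil i) ∈ I.induced S i ∧
    ∀ a b : Fin I.n, [a, b] <:+: I.induced S i →
      frechetDist ([a, b].map I.bend) ((subPolyline (I.line i) a b).map I.bend) ≤ ε

/-- The minimum number of bends retained by a simplification with error at most `δ`. (The set of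
all bends is always such a simplification, so this is a minimum over a nonempty set.) -/
def opt : ℕ :=
  sInf {k : ℕ | ∃ S : Finset (Fin I.n), I.IsSimplification I.δ S ∧ S.card = k}

end PBSInstance

/-! ## The real RAM

Programs are finite and written in structured form (sequence, branching, loops). The memory consists
of arrays of natural numbers and arrays of real numbers, addressed by a fixed name and a computed
index; a scalar variable is an array of which only one cell is used. Natural numbers can be added,
subtracted and compared, real numbers can be added, subtracted, multiplied, divided and compared.
There is no rounding and no other passage from real numbers to natural numbers. Every memory access
and every operation costs one unit of time. -/

namespace RealRAM

/-- The memory: cell `j` of the natural-number array `a` and of the real-number array `a`. -/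
structure State where
  nat : ℕ → ℕ → ℕ
  real : ℕ → ℕ → ℝ

/-- Expressions with natural-number values; `read a e` is cell `e` of array `a`, and `sub` is
truncated subtraction. -/
inductive NExp where
  | lit (k : ℕ)
  | read (a : ℕ) (e : NExp)
  | add (e f : NExp)
  | sub (e f : NExp)

/-- Expressions with real values; the literals are natural numbers. -/
inductive RExp where
  | lit (k : ℕ)
  | read (a : ℕ) (e : NExp)
  | add (e f : RExp)
  | sub (e f : RExp)
  | mul (e f : RExp)
  | div (e f : RExp)

/-- Tests. -/
inductive Test where
  | nle (e f : NExp)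
  | rle (e f : RExp)
  | neg (p : Test)
  | conj (p q : Test)

/-- Programs: do nothing, store a value in cell `i` of array `a`, sequence, branching, loop. -/
inductive Program where
  | skip
  | nset (a : ℕ) (i e : NExp)
  | rset (a : ℕ) (i : NExp) (e : RExp)
  | seq (c d : Program)
  | branch (p : Test) (c d : Program)
  | loop (p : Test) (c : Program)

namespace NExp

def val (s : State) : NExp → ℕ
  | lit k => k
  | read a e => s.nat a (e.val s)
  | add e f => e.val s + f.val s
  | sub e f => e.val s - f.val s

/-- The number of steps spent on evaluating the expression. -/
def cost : NExp → ℕ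
  | lit _ => 1
  | read _ e => e.cost + 1
  | add e f => e.cost + f.cost + 1
  | sub e f => e.cost + f.cost + 1

end NExp

namespace RExp

/-- Division by `0` yields `0`. -/
def val (s : State) : RExp → ℝ
  | lit k => (k : ℝ)
  | read a e => s.real a (e.val s)
  | add e f => e.val s + f.val s
  | sub e f => e.val s - f.val s
  | mul e f => e.val s * f.val s
  | div e f => e.val s / f.val s

/-- The number of steps spent on evaluating the expression. -/
def cost : RExp → ℕ
  | lit _ => 1
  | read _ e => e.cost + 1
  | add e f => e.cost + f.cost + 1
  | sub e f => e.cost + f.cost + 1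
  | mul e f => e.cost + f.cost + 1
  | div e f => e.cost + f.cost + 1

end RExp

namespace Test

def Holds (s : State) : Test → Prop
  | nle e f => e.val s ≤ f.val s
  | rle e f => e.val s ≤ f.val s
  | neg p => ¬ p.Holds s
  | conj p q => p.Holds s ∧ q.Holds s

/-- The number of steps spent on evaluating the test. -/
def cost : Test → ℕ
  | nle e f => e.cost + f.cost + 1
  | rle e f => e.cost + f.cost + 1
  | neg p => p.cost + 1
  | conj p q => p.cost + q.cost + 1

end Test

namespace State

def nstore (s : State) (a j v : ℕ) : State :=
  { s with nat := Function.update s.nat a (Function.update (s.nat a) j v) }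

def rstore (s : State) (a j : ℕ) (v : ℝ) : State :=
  { s with real := Function.update s.real a (Function.update (s.real a) j v) }

end State

/-- `Runs c s t s'`: the program `c`, started in memory `s`, halts after exactly `t` steps in
memory `s'`. -/
inductive Runs : Program → State → ℕ → State → Prop where
  | skip (s : State) : Runs .skip s 1 s
  | nset (s : State) (a : ℕ) (i e : NExp) :
      Runs (.nset a i e) s (i.cost + e.cost + 1) (s.nstore a (i.val s) (e.val s))
  | rset (s : State) (a : ℕ) (i : NExp) (e : RExp) :
      Runs (.rset a i e) s (i.cost + e.cost + 1) (s.rstore a (i.val s) (e.val s))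
  | seq {c d : Program} {s s' s'' : State} {t u : ℕ}
      (hc : Runs c s t s') (hd : Runs d s' u s'') : Runs (.seq c d) s (t + u) s''
  | branch_true {p : Test} {c d : Program} {s s' : State} {t : ℕ}
      (hp : p.Holds s) (hc : Runs c s t s') : Runs (.branch p c d) s (p.cost + t) s'
  | branch_false {p : Test} {c d : Program} {s s' : State} {t : ℕ}
      (hp : ¬ p.Holds s) (hd : Runs d s t s') : Runs (.branch p c d) s (p.cost + t) s'
  | loop_done {p : Test} {c : Program} {s : State}
      (hp : ¬ p.Holds s) : Runs (.loop p c) s p.cost s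
  | loop_step {p : Test} {c : Program} {s s' s'' : State} {t u : ℕ}
      (hp : p.Holds s) (hc : Runs c s t s') (hl : Runs (.loop p c) s' u s'') :
      Runs (.loop p c) s (p.cost + t + u) s''

end RealRAM

/-! ## Input and output of the machine -/

namespace PBSInstance

variable (I : PBSInstance)

/-- The polylines written one after the other, each as the list of the indices of its bends. -/
def lineData : List ℕ :=
  ((List.ofFn I.line).flatten).map (fun v => (v : ℕ))

/-- The position in `lineData` at which the `i`-th polyline starts; for `i = ℓ` the total length. -/
def lineStart (i : ℕ) : ℕ :=
  (((List.ofFn I.line).take i).map List.length).sum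

/-- The initial memory for an instance. Natural-number arrays: array `0` holds `n`, array `1`
holds `ℓ`, array `2` holds the starting positions `lineStart 0, …, lineStart ℓ`, and array `3`
holds `lineData`. Real arrays: array `0` holds the first and array `1` the second coordinates of the
bends, array `2` holds `δ`. All other cells contain `0`. -/
def input : RealRAM.State where
  nat a j :=
    match a with
    | 0 => if j = 0 then I.n else 0
    | 1 => if j = 0 then I.ℓ else 0
    | 2 => if j ≤ I.ℓ then I.lineStart j else 0
    | 3 => I.lineData.getD j 0
    | _ => 0
  real a j :=
    match a with
    | 0 => if h : j < I.n then I.bend ⟨j, h⟩ 0 else 0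
    | 1 => if h : j < I.n then I.bend ⟨j, h⟩ 1 else 0
    | 2 => if j = 0 then I.δ else 0
    | _ => 0

/-- The set of bends that a final memory describes: bend `v` belongs to the output if and only if
cell `v` of the natural-number array `4` is nonzero. -/
def output (s : RealRAM.State) : Finset (Fin I.n) :=
  Finset.univ.filter (fun v : Fin I.n => s.nat 4 (v : ℕ) ≠ 0)

end PBSInstance

end

/-!
The problem is reduced to a hitting set problem for intervals. A pair of positions `p < q` of a
polyline is a shortcut of error `ε` if the segment between the two bends has Fréchet distance at most
`ε` to the part of the polyline between them (`IsShortcut`; for segments the Fréchet distance only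
depends on when the vertices are passed, see `isShortcut_of_frechetDist_le` and
`frechetDist_le_of_isShortcut`). Shortening a shortcut at most doubles its error
(`IsShortcut.sub`). Hence, if `p < q` is not a shortcut of error `2 δ`, then every `δ`-simplification
retains a bend strictly between `p` and `q`, since otherwise one of its segments would be a shortcut
that spans both positions (`IsSimplification.exists_between`). Conversely, a set of bends that
contains all end points and a bend strictly inside every failing pair is a `2 δ`-simplification
(`isSimplification_of_isShortcut`). It suffices to hit, for each `p`, the interval up to the first
failing partner of `p`; this leaves at most `ℓ n` intervals. All end points belong to every solution,
and the greedy algorithm finds a hitting set of the intervals that has at most `OPT log (ℓ n) + 1`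
elements (`GreedyHitting.Inv.card_le`).

A pair of positions is tested by a greedy traversal of the chords that the discs about the vertices
cut out of the segment (`isShortcut_iff`). The ends of the chords involve square roots, which the
machine lacks, so they are compared by squaring (`sub_sqrt_le_add_sqrt_iff`,
`sub_sqrt_le_sub_sqrt_iff`). One test takes `O(n)` steps, and there are at most `ℓ n²` pairs. A round
of the greedy algorithm counts all occurrences of bends in the remaining intervals afresh, in
`O(ℓ n²)` steps, and `n` rounds suffice. Both phases thus run in time `O(ℓ n³)`.

Programs are treated with a total-correctness judgement with a time bound (`RealRAM.Ensures`), whose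
main rule is `RealRAM.Ensures.forLoop`. Natural-number arrays `0` to `3` and real arrays `0` to `2`
hold the input and are never written. Array `4` is the output, `5` holds the right ends of the
intervals, `6` the numbers of occurrences and `7` the selected bend; `8` is a copy of the right end
of an interval; `10` to `16` are loop counters and the result of a test. Real arrays `3` to `6` belong
to the traversal.
-/

/-! ### Shortcuts of a sequence of points -/

/-- The segment from `P a` to `P b` can be traversed monotonically so that it meets `P a, …, P b` in
this order up to distance `ε`: for a polygonal curve with these vertices this says that its Fréchet
distance to the segment is at most `ε`. -/
def IsShortcut (P : ℕ → Plane) (ε : ℝ) (a b : ℕ) : Prop :=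
  ∃ t : ℕ → ℝ, MonotoneOn t (Set.Icc a b) ∧ t a = 0 ∧ t b = 1 ∧
    ∀ j ∈ Set.Icc a b, dist (AffineMap.lineMap (P a) (P b) (t j)) (P j) ≤ ε

theorem dist_lineMap_lineMap_le_of_le {x y x' y' : Plane} {s r : ℝ} (h0 : 0 ≤ s) (h1 : s ≤ 1)
    (hx : dist x x' ≤ r) (hy : dist y y' ≤ r) :
    dist (AffineMap.lineMap x y s) (AffineMap.lineMap x' y' s) ≤ r := by
  rw [AffineMap.lineMap_apply_module, AffineMap.lineMap_apply_module]
  calc dist ((1 - s) • x + s • y) ((1 - s) • x' + s • y')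
      ≤ dist ((1 - s) • x) ((1 - s) • x') + dist (s • y) (s • y') := dist_add_add_le _ _ _ _
    _ = (1 - s) * dist x x' + s * dist y y' := by
        rw [dist_smul₀, dist_smul₀, Real.norm_of_nonneg h0, Real.norm_of_nonneg (by linarith)]
    _ ≤ (1 - s) * r + s * r := by
        have := sub_nonneg.2 h1
        gcongr
    _ = r := by ring

/-- Shortening a shortcut at most doubles its error: the new segment stays within `ε` of the part of
the old segment that is matched with its end points. -/
theorem IsShortcut.sub {P : ℕ → Plane} {ε : ℝ} {a b c d : ℕ} (h : IsShortcut P ε a b)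
    (hac : a ≤ c) (hcd : c < d) (hdb : d ≤ b) : IsShortcut P (2 * ε) c d := by
  obtain ⟨t, hm, -, -, ht⟩ := h
  have mem : ∀ j, c ≤ j → j ≤ d → j ∈ Set.Icc a b := fun j h1 h2 => ⟨by omega, by omega⟩
  have hle : ∀ i j, c ≤ i → i ≤ j → j ≤ d → t i ≤ t j := fun i j h1 h2 h3 =>
    hm (mem i h1 (by omega)) (mem j (by omega) h3) h2
  have hΔ : 0 ≤ t d - t c := sub_nonneg.2 (hle c d le_rfl hcd.le le_rfl)
  -- If `t c = t d`, the division by zero yields the weight `0` for all vertices but the last.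
  have h01 : ∀ j, c ≤ j → j ≤ d → 0 ≤ (t j - t c) / (t d - t c) ∧
      (t j - t c) / (t d - t c) ≤ 1 := fun j h1 h2 =>
    ⟨div_nonneg (sub_nonneg.2 (hle c j le_rfl h1 h2)) hΔ,
      div_le_one_of_le₀ (by linarith [hle j d h1 h2 le_rfl]) hΔ⟩
  refine ⟨fun j => if j = d then 1 else (t j - t c) / (t d - t c), ?_, ?_, by simp, ?_⟩
  · rintro i ⟨hi1, hi2⟩ j ⟨hj1, hj2⟩ hij
    dsimp only
    split_ifs with h1 h2 h2
    · exact le_rfl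
    · omega
    · exact (h01 i hi1 hi2).2
    · have := hle i j hi1 hij hj2
      gcongr
  · simp [hcd.ne]
  · rintro j ⟨hj1, hj2⟩
    set s : ℝ := if j = d then 1 else (t j - t c) / (t d - t c) with hs
    have hs01 : 0 ≤ s ∧ s ≤ 1 := by
      rw [hs]
      split_ifs
      · simp
      · exact h01 j hj1 hj2
    have hts : AffineMap.lineMap (t c) (t d) s = t j := by
      rw [AffineMap.lineMap_apply_ring', hs]
      split_ifs with hjd
      · subst hjd; ring
      · rcases hΔ.eq_or_lt with h0 | h0
        · have h1 := hle c j le_rfl hj1 hj2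
          have h2 := hle j d hj1 hj2 le_rfl
          rw [← h0]
          simp only [mul_zero, zero_add]
          linarith
        · field_simp
          ring
    have key : AffineMap.lineMap (AffineMap.lineMap (P a) (P b) (t c))
        (AffineMap.lineMap (P a) (P b) (t d)) s = AffineMap.lineMap (P a) (P b) (t j) := by
      rw [← hts, AffineMap.apply_lineMap]
    have hc := ht c (mem c le_rfl hcd.le)
    have hd := ht d (mem d hcd.le le_rfl)
    rw [dist_comm] at hc hd
    calc _ ≤ _ := dist_triangle _ (AffineMap.lineMap (P a) (P b) (t j)) _
      _ ≤ ε + ε := by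
        rw [← key]
        refine add_le_add (dist_lineMap_lineMap_le_of_le hs01.1 hs01.2 hc hd) ?_
        rw [key]
        exact ht j (mem j hj1 hj2)
      _ = 2 * ε := by ring

theorem isShortcut_succ {P : ℕ → Plane} {ε : ℝ} (hε : 0 ≤ ε) (a : ℕ) :
    IsShortcut P ε a (a + 1) := by
  refine ⟨fun j => if j ≤ a then 0 else 1, ?_, by simp, by simp, ?_⟩
  · intro i _ j _ hij
    dsimp only
    split_ifs <;> first | omega | norm_num
  · rintro j ⟨h1, h2⟩
    rcases h1.eq_or_lt with rfl | h1
    · simpa using hε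
    · obtain rfl : j = a + 1 := by omega
      simpa using hε

/-! ### Shortcuts and the Fréchet distance -/

theorem polylineCurve_add (L : List Plane) (m : ℕ) {s : ℝ} (h0 : 0 ≤ s) (h1 : s ≤ 1) :
    polylineCurve L (m + s) = AffineMap.lineMap (L.getD m 0) (L.getD (m + 1) 0) s := by
  rw [AffineMap.lineMap_apply_module, polylineCurve]
  rcases h0.eq_or_lt with rfl | h0
  · simp
  rcases h1.eq_or_lt with rfl | h1
  · have hc : (m : ℝ) + 1 = ((m + 1 : ℕ) : ℝ) := by push_cast; rfl
    rw [hc, Nat.floor_natCast, Nat.ceil_natCast]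
    simp
  · have hf : ⌊(m : ℝ) + s⌋₊ = m := by
      rw [Nat.floor_eq_iff (by positivity)]
      constructor <;> linarith
    have hc : ⌈(m : ℝ) + s⌉₊ = m + 1 := by
      rw [Nat.ceil_eq_iff (by omega)]
      constructor
      · simpa using h0
      · push_cast; linarith
    rw [hf, hc]
    congr 2 <;> ring

theorem polylineCurve_natCast (L : List Plane) (m : ℕ) : polylineCurve L m = L.getD m 0 := by
  have := polylineCurve_add L m le_rfl zero_le_one
  simpa using this

theorem polylineCurve_pair (a b : Plane) {s : ℝ} (h0 : 0 ≤ s) (h1 : s ≤ 1) :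
    polylineCurve [a, b] s = AffineMap.lineMap a b s := by
  have := polylineCurve_add [a, b] 0 h0 h1
  simpa using this

/-- The piecewise linear function on `[0, k]` with the values `t 0, …, t k` at the integers. -/
def piecewiseLinear (t : ℕ → ℝ) (k : ℕ) (y : ℝ) : ℝ :=
  t 0 + ∑ j ∈ Finset.range k, max 0 (min 1 (y - j)) * (t (j + 1) - t j)

theorem continuous_piecewiseLinear (t : ℕ → ℝ) (k : ℕ) : Continuous (piecewiseLinear t k) := by
  unfold piecewiseLinear
  fun_prop

theorem monotone_piecewiseLinear {t : ℕ → ℝ} {k : ℕ} (ht : MonotoneOn t (Set.Icc 0 k)) :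
    Monotone (piecewiseLinear t k) := by
  intro y z hyz
  unfold piecewiseLinear
  gcongr with j hj
  have hj' := Finset.mem_range.1 hj
  exact sub_nonneg.2 (ht ⟨by omega, by omega⟩ ⟨by omega, by omega⟩ (Nat.le_succ j))

theorem piecewiseLinear_add (t : ℕ → ℝ) {k m : ℕ} (hm : m < k) {s : ℝ} (h0 : 0 ≤ s)
    (h1 : s ≤ 1) :
    piecewiseLinear t k (m + s) = AffineMap.lineMap (t m) (t (m + 1)) s := by
  obtain ⟨r, rfl⟩ : ∃ r, k = (m + 1) + r := ⟨k - (m + 1), by omega⟩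
  rw [piecewiseLinear, Finset.sum_range_add, Finset.sum_range_succ, AffineMap.lineMap_apply_ring']
  have e1 : ∑ j ∈ Finset.range m, max 0 (min 1 ((m : ℝ) + s - j)) * (t (j + 1) - t j)
      = t m - t 0 := by
    rw [← Finset.sum_range_sub]
    refine Finset.sum_congr rfl fun j hj => ?_
    have : (j : ℝ) + 1 ≤ m := by exact_mod_cast Finset.mem_range.1 hj
    rw [min_eq_left (by linarith), max_eq_right zero_le_one, one_mul]
  have e2 : ∑ j ∈ Finset.range r, max 0 (min 1 ((m : ℝ) + s - ((m + 1 + j : ℕ) : ℝ))) *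
      (t (m + 1 + j + 1) - t (m + 1 + j)) = 0 := by
    refine Finset.sum_eq_zero fun j _ => ?_
    have : (0 : ℝ) ≤ j := by positivity
    rw [max_eq_left ((min_le_right _ _).trans (by push_cast; linarith)), zero_mul]
  rw [e1, e2, add_sub_cancel_left, min_eq_right h1, max_eq_right h0]
  ring

/-- Monotone parameters for the vertices extend linearly to reparametrisations; as the distance is
convex in between, its maximum is attained at a vertex. -/
theorem exists_mem_frechet_of_monotone {L : List Plane} {k : ℕ} (hk : 0 < k)
    (hL : L.length = k + 1) {t : ℕ → ℝ} (ht : MonotoneOn t (Set.Icc 0 k)) (t0 : t 0 = 0)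
    (t1 : t k = 1) (a b : Plane) :
    ∃ j ∈ Set.Icc 0 k, ∃ α β : ℝ → ℝ, IsReparam [a, b] α ∧ IsReparam L β ∧
      IsGreatest ((fun u => dist (polylineCurve [a, b] (α u)) (polylineCurve L (β u))) ''
        Set.Icc 0 1) (dist (AffineMap.lineMap a b (t j)) (L.getD j 0)) := by
  have hk' : (0 : ℝ) < k := by exact_mod_cast hk
  have t01 : ∀ j ≤ k, 0 ≤ t j ∧ t j ≤ 1 := fun j hj =>
    ⟨t0 ▸ ht ⟨le_rfl, hk.le⟩ ⟨zero_le, hj⟩ zero_le,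
      t1 ▸ ht ⟨zero_le, hj⟩ ⟨hk.le, le_rfl⟩ hj⟩
  obtain ⟨j, hj, hmax⟩ := Finset.exists_max_image (Finset.range (k + 1))
    (fun j => dist (AffineMap.lineMap a b (t j)) (L.getD j 0)) ⟨0, by simp⟩
  have hjk : j ≤ k := by simpa [Nat.lt_succ_iff] using hj
  -- Writing a parameter as `m + s` with `m < k` and `s ∈ [0, 1]`.
  have split : ∀ y : ℝ, 0 ≤ y → y ≤ k → ∃ m < k, ∃ s : ℝ, 0 ≤ s ∧ s ≤ 1 ∧ y = m + s := by
    intro y h0 h1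
    rcases h1.eq_or_lt with rfl | h1
    · refine ⟨k - 1, by omega, 1, zero_le_one, le_rfl, ?_⟩
      rw [Nat.cast_pred hk]; ring
    · refine ⟨⌊y⌋₊, (Nat.floor_lt h0).2 h1, y - ⌊y⌋₊, sub_nonneg.2 (Nat.floor_le h0), ?_, by ring⟩
      linarith [Nat.lt_floor_add_one y]
  have vert : ∀ m ≤ k, piecewiseLinear t k m = t m := by
    intro m hm
    rcases hm.eq_or_lt with rfl | hm
    · obtain ⟨r, rfl⟩ : ∃ r, m = r + 1 := ⟨m - 1, by omega⟩
      have := piecewiseLinear_add t (Nat.lt_succ_self r) zero_le_one le_rfl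
      push_cast
      simpa using this
    · have := piecewiseLinear_add t hm le_rfl zero_le_one
      simpa using this
  refine ⟨j, ⟨zero_le, hjk⟩, fun u => piecewiseLinear t k (k * u), fun u => k * u,
    ⟨?_, ?_, ?_, ?_⟩, ⟨?_, ?_, ?_, ?_⟩, ⟨?_, ?_⟩⟩
  · exact ((continuous_piecewiseLinear t k).comp (by fun_prop)).continuousOn
  · intro u _ v _ huv
    exact monotone_piecewiseLinear ht (by gcongr)
  · have := vert 0 hk.le
    simpa [t0] using this
  · have := vert k le_rfl
    simp only [mul_one, this, t1]
    norm_num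
  · fun_prop
  · intro u _ v _ huv
    dsimp only
    gcongr
  · simp
  · simp [hL]
  · refine ⟨j / k, ⟨by positivity, ?_⟩, ?_⟩
    · rw [div_le_one hk']
      exact_mod_cast hjk
    · have e : (k : ℝ) * (j / k) = j := by field_simp
      simp only [e, vert j hjk, polylineCurve_natCast]
      rw [polylineCurve_pair a b (t01 j hjk).1 (t01 j hjk).2]
  · rintro _ ⟨u, ⟨hu0, hu1⟩, rfl⟩
    obtain ⟨m, hm, s, hs0, hs1, e⟩ := split (k * u) (by positivity)
      (by nlinarith)
    simp only [e]
    rw [piecewiseLinear_add t hm hs0 hs1, polylineCurve_add L m hs0 hs1]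
    have hm1 := t01 m hm.le
    have hm2 := t01 (m + 1) hm
    have hmem : AffineMap.lineMap (t m) (t (m + 1)) s ∈ Set.Icc (0 : ℝ) 1 := by
      rw [AffineMap.lineMap_apply_ring]
      constructor <;> nlinarith
    rw [polylineCurve_pair a b hmem.1 hmem.2, AffineMap.apply_lineMap]
    exact dist_lineMap_lineMap_le_of_le hs0 hs1 (hmax m (by simp; omega))
      (hmax (m + 1) (by simp; omega))

theorem frechetDist_le_of_isShortcut {L : List Plane} {k : ℕ} (hk : 0 < k)
    (hL : L.length = k + 1) {ε : ℝ} (h : IsShortcut (fun j => L.getD j 0) ε 0 k) :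
    frechetDist [L.getD 0 0, L.getD k 0] L ≤ ε := by
  obtain ⟨t, ht, t0, t1, hd⟩ := h
  obtain ⟨j, hj, α, β, hα, hβ, hG⟩ :=
    exists_mem_frechet_of_monotone hk hL ht t0 t1 (L.getD 0 0) (L.getD k 0)
  refine le_trans (csInf_le ?_ ?_) (hd j hj)
  swap
  · exact ⟨α, β, hα, hβ, hG⟩
  refine ⟨0, ?_⟩
  rintro r ⟨α, β, -, -, ⟨u, -, rfl⟩, -⟩
  exact dist_nonneg

/-- The times at which a reparametrisation passes the vertices. -/
theorem IsReparam.exists_times {L : List Plane} {k : ℕ} (hk : 0 < k) (hL : L.length = k + 1)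
    {β : ℝ → ℝ} (hβ : IsReparam L β) : ∃ s : ℕ → ℝ, s 0 = 0 ∧ s k = 1 ∧
      MonotoneOn s (Set.Icc 0 k) ∧ ∀ j ∈ Set.Icc 0 k, s j ∈ Set.Icc (0 : ℝ) 1 ∧ β (s j) = j := by
  obtain ⟨hc, hm, h0, h1⟩ := hβ
  rw [hL] at h1
  have h1' : β 1 = k := by rw [h1]; push_cast; ring
  have ex : ∀ j : ℕ, ∃ s : ℝ, j ∈ Set.Icc 0 k →
      (s ∈ Set.Icc (0 : ℝ) 1 ∧ β s = j ∧ (j = 0 → s = 0) ∧ (j = k → s = 1)) := by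
    intro j
    by_cases hj0 : j = 0
    · exact ⟨0, fun _ => ⟨by simp, by simp [h0, hj0], fun _ => rfl, fun h => by omega⟩⟩
    by_cases hjk : j = k
    · exact ⟨1, fun _ => ⟨by simp, by simp [h1', hjk], fun h => by omega, fun _ => rfl⟩⟩
    by_cases hj : j ≤ k
    · have : (j : ℝ) ∈ Set.Icc (β 0) (β 1) := by
        rw [h0, h1']
        exact ⟨by positivity, by exact_mod_cast hj⟩
      obtain ⟨s, hs, hsj⟩ := intermediate_value_Icc zero_le_one hc this
      exact ⟨s, fun _ => ⟨hs, hsj, fun h => absurd h hj0, fun h => absurd h hjk⟩⟩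
    · exact ⟨0, fun h => absurd h.2 hj⟩
  choose s hs using ex
  refine ⟨s, (hs 0 ⟨le_rfl, hk.le⟩).2.2.1 rfl, (hs k ⟨hk.le, le_rfl⟩).2.2.2 rfl, ?_,
    fun j hj => ⟨(hs j hj).1, (hs j hj).2.1⟩⟩
  intro i hi j hj hij
  by_contra hlt
  have := hm (hs j hj).1 (hs i hi).1 (not_le.1 hlt).le
  rw [(hs i hi).2.1, (hs j hj).2.1] at this
  have hji : j ≤ i := by exact_mod_cast this
  exact hlt (le_of_eq (by rw [le_antisymm hij hji]))

/-- The infimum in the Fréchet distance to a segment is attained as far as the vertices are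
concerned, by compactness of the set of monotone sequences of parameters. -/
theorem isShortcut_of_frechetDist_le {L : List Plane} {k : ℕ} (hk : 0 < k)
    (hL : L.length = k + 1) {ε : ℝ} (h : frechetDist [L.getD 0 0, L.getD k 0] L ≤ ε) :
    IsShortcut (fun j => L.getD j 0) ε 0 k := by
  set a := L.getD 0 0 with ha
  set b := L.getD k 0 with hb
  -- `K m` consists of the admissible parameters for the error `ε + 1 / (m + 1)`.
  let K : ℕ → Set (ℕ → ℝ) := fun m => {t | (∀ j, t j ∈ Set.Icc (0 : ℝ) 1) ∧
    (∀ i j, i ≤ j → j ≤ k → t i ≤ t j) ∧ t 0 = 0 ∧ t k = 1 ∧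
    ∀ j ≤ k, dist (AffineMap.lineMap a b (t j)) (L.getD j 0) ≤ ε + 1 / ((m : ℝ) + 1)}
  have hclosed : ∀ m, IsClosed (K m) := by
    intro m
    simp only [K, Set.ofPred_and, Set.ofPred_forall]
    refine IsClosed.inter ?_ (IsClosed.inter ?_ (IsClosed.inter ?_ (IsClosed.inter ?_ ?_)))
    · exact isClosed_iInter fun j => isClosed_Icc.preimage (continuous_apply j)
    · refine isClosed_iInter fun i => isClosed_iInter fun j => isClosed_iInter fun _ =>
        isClosed_iInter fun _ => ?_
      exact isClosed_le (continuous_apply i) (continuous_apply j)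
    · exact isClosed_eq (continuous_apply 0) continuous_const
    · exact isClosed_eq (continuous_apply k) continuous_const
    · refine isClosed_iInter fun j => isClosed_iInter fun _ => ?_
      refine isClosed_le ?_ continuous_const
      exact (AffineMap.lineMap_continuous.comp (continuous_apply j)).dist continuous_const
  have hcompact : IsCompact (K 0) :=
    (isCompact_univ_pi fun _ : ℕ => isCompact_Icc (a := (0 : ℝ)) (b := 1)).of_isClosed_subset
      (hclosed 0) fun t ht j _ => ht.1 j
  have hanti : ∀ m, K (m + 1) ⊆ K m := by
    rintro m t ⟨h1, h2, h3, h4, h5⟩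
    refine ⟨h1, h2, h3, h4, fun j hj => (h5 j hj).trans ?_⟩
    push_cast
    gcongr
    linarith
  have hne : ∀ m, (K m).Nonempty := by
    intro m
    have hlt : frechetDist [a, b] L < ε + 1 / ((m : ℝ) + 1) := by
      have : (0 : ℝ) < 1 / ((m : ℝ) + 1) := by positivity
      linarith
    -- Some pair of reparametrisations exists, so the infimum is not one over the empty set.
    have hex : {r : ℝ | ∃ α β : ℝ → ℝ, IsReparam [a, b] α ∧ IsReparam L β ∧
        IsGreatest ((fun t => dist (polylineCurve [a, b] (α t)) (polylineCurve L (β t))) ''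
          Set.Icc 0 1) r}.Nonempty := by
      obtain ⟨j, -, hG⟩ := exists_mem_frechet_of_monotone hk hL (t := fun j => (j : ℝ) / k)
        (fun i _ j _ hij => by dsimp only; gcongr) (by simp)
        (div_self (by exact_mod_cast hk.ne')) a b
      exact ⟨_, hG⟩
    obtain ⟨r, ⟨α, β, hα, hβ, hG⟩, hr⟩ := exists_lt_of_csInf_lt hex hlt
    obtain ⟨s, s0, s1, hsm, hs⟩ := hβ.exists_times hk hL
    obtain ⟨-, hαm, hα0, hα1⟩ := hα
    have hα1' : α 1 = 1 := by rw [hα1]; simp; norm_num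
    have hα01 : ∀ u ∈ Set.Icc (0 : ℝ) 1, α u ∈ Set.Icc (0 : ℝ) 1 := fun u hu =>
      ⟨hα0 ▸ hαm (by simp) hu hu.1, hα1' ▸ hαm hu (by simp) hu.2⟩
    refine ⟨fun j => α (s (min j k)), ?_, ?_, by simp [s0, hα0], by simp [s1, hα1'], ?_⟩
    · exact fun j => hα01 _ (hs _ ⟨zero_le, min_le_right _ _⟩).1
    · intro i j hij hjk
      have hi : min i k ∈ Set.Icc 0 k := ⟨zero_le, min_le_right _ _⟩
      have hj : min j k ∈ Set.Icc 0 k := ⟨zero_le, min_le_right _ _⟩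
      exact hαm (hs _ hi).1 (hs _ hj).1 (hsm hi hj (by omega))
    · intro j hj
      have hjm : j ∈ Set.Icc 0 k := ⟨zero_le, hj⟩
      have := hG.2 ⟨s j, (hs j hjm).1, rfl⟩
      simp only [(hs j hjm).2, polylineCurve_natCast] at this
      have h01 := hα01 _ (hs j hjm).1
      rw [polylineCurve_pair a b h01.1 h01.2] at this
      simp only [min_eq_left hj]
      exact this.trans hr.le
  obtain ⟨t, ht⟩ := IsCompact.nonempty_iInter_of_sequence_nonempty_isCompact_isClosed K hanti hne
    hcompact hclosed
  rw [Set.mem_iInter] at ht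
  obtain ⟨-, h2, h3, h4, -⟩ := ht 0
  refine ⟨t, fun i _ j hj hij => h2 i j hij hj.2, h3, h4, fun j hj => ?_⟩
  have hlim : Filter.Tendsto (fun m : ℕ => ε + 1 / ((m : ℝ) + 1)) Filter.atTop (nhds (ε + 0)) :=
    tendsto_const_nhds.add tendsto_one_div_add_atTop_nhds_zero_nat
  rw [add_zero] at hlim
  exact ge_of_tendsto' hlim fun m => (ht m).2.2.2.2 j hj.2

/-! ### Deciding shortcuts by rational operations -/

section Decision

variable (P : ℕ → Plane) (ε : ℝ) (p q : ℕ)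

/-- The inner product of `P j - P p` with `P q - P p`: the position of the projection of `P j` to
the line through `P p` and `P q`, in the scale where `P q` has position `|P q - P p|²`. -/
def projPos (j : ℕ) : ℝ :=
  (P j 0 - P p 0) * (P q 0 - P p 0) + (P j 1 - P p 1) * (P q 1 - P p 1)

/-- The distance of `P j` from the line through `P p` and `P q`, up to sign and in the scale of
`projPos`. -/
def projOff (j : ℕ) : ℝ :=
  (P j 0 - P p 0) * (P q 1 - P p 1) - (P j 1 - P p 1) * (P q 0 - P p 0)

/-- The square of half the length of the chord that the disc of radius `ε` about `P j` cuts out of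
the line through `P p` and `P q`, in the scale of `projPos`; negative if the line misses the
disc. -/
def chordSq (j : ℕ) : ℝ :=
  ε * ε * projPos P p q q - projOff P p q j * projOff P p q j

/-- The largest of `0` and the left end points of the chords of `P (p + 1), …, P (j - 1)`: the
smallest position at which a monotone traversal can have passed all these points. -/
noncomputable def reach : ℕ → ℝ
  | 0 => 0
  | j + 1 => if p < j then max (reach j) (projPos P p q j - √(chordSq P ε p q j)) else 0

variable {P ε p q}

theorem reach_of_le {j : ℕ} (hj : j ≤ p + 1) : reach P ε p q j = 0 := by
  cases j with
  | zero => rfl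
  | succ j => rw [reach, if_neg (by omega)]

theorem reach_succ {j : ℕ} (hj : p < j) : reach P ε p q (j + 1) =
    max (reach P ε p q j) (projPos P p q j - √(chordSq P ε p q j)) := by
  rw [reach, if_pos hj]

theorem monotone_reach : Monotone (reach P ε p q) := by
  refine monotone_nat_of_le_succ fun j => ?_
  by_cases hj : p < j
  · rw [reach_succ hj]
    exact le_max_left _ _
  · rw [reach_of_le (by omega), reach_of_le (by omega)]

theorem projPos_self_pos (hP : P p ≠ P q) : 0 < projPos P p q q := by
  have h0 : 0 ≤ projPos P p q q := by
    exact add_nonneg (mul_self_nonneg _) (mul_self_nonneg _)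
  refine lt_of_le_of_ne h0 fun h => hP ?_
  unfold projPos at h
  ext i
  fin_cases i
  · have : P q 0 - P p 0 = 0 := by nlinarith [sq_nonneg (P q 0 - P p 0), sq_nonneg (P q 1 - P p 1)]
    simpa using (sub_eq_zero.1 this).symm
  · have : P q 1 - P p 1 = 0 := by nlinarith [sq_nonneg (P q 0 - P p 0), sq_nonneg (P q 1 - P p 1)]
    simpa using (sub_eq_zero.1 this).symm

theorem projPos_mul_dist_sq (j : ℕ) (t : ℝ) :
    projPos P p q q * dist (AffineMap.lineMap (P p) (P q) t) (P j) ^ 2 =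
      (projPos P p q q * t - projPos P p q j) ^ 2 + projOff P p q j ^ 2 := by
  rw [EuclideanSpace.dist_eq, Real.sq_sqrt (by positivity), AffineMap.lineMap_apply_module]
  simp only [Fin.sum_univ_two, Real.dist_eq, sq_abs, PiLp.add_apply, PiLp.smul_apply, smul_eq_mul]
  unfold projPos projOff
  ring

theorem dist_lineMap_le_iff (hP : P p ≠ P q) (hε : 0 ≤ ε) (j : ℕ) (t : ℝ) :
    dist (AffineMap.lineMap (P p) (P q) t) (P j) ≤ ε ↔
      0 ≤ chordSq P ε p q j ∧
      projPos P p q j - √(chordSq P ε p q j) ≤ projPos P p q q * t ∧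
      projPos P p q q * t ≤ projPos P p q j + √(chordSq P ε p q j) := by
  have hW := projPos_self_pos hP
  have e := projPos_mul_dist_sq (P := P) (p := p) (q := q) j t
  have h1 : dist (AffineMap.lineMap (P p) (P q) t) (P j) ≤ ε ↔
      (projPos P p q q * t - projPos P p q j) ^ 2 ≤ chordSq P ε p q j := by
    rw [← pow_le_pow_iff_left₀ dist_nonneg hε two_ne_zero, ← mul_le_mul_iff_right₀ hW, e, chordSq]
    constructor <;> intro h <;> nlinarith
  rw [h1]
  constructor
  · intro h
    have h0 := (sq_nonneg _).trans h
    have := abs_le.1 (Real.abs_le_sqrt h)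
    exact ⟨h0, by linarith [this.1], by linarith [this.2]⟩
  · rintro ⟨h0, h2, h3⟩
    rw [← Real.sq_sqrt h0]
    exact sq_le_sq' (by linarith) (by linarith)

/-- The greedy traversal decides whether a segment is a shortcut: always moving on to the smallest
admissible position succeeds if anything does. -/
theorem isShortcut_iff (hP : P p ≠ P q) (hε : 0 ≤ ε) (hpq : p < q) : IsShortcut P ε p q ↔
    (∀ j, p < j → j < q → 0 ≤ chordSq P ε p q j ∧
      reach P ε p q j ≤ projPos P p q j + √(chordSq P ε p q j)) ∧
    reach P ε p q q ≤ projPos P p q q := by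
  have hW := projPos_self_pos hP
  constructor
  · rintro ⟨t, hm, t0, t1, ht⟩
    simp only [dist_lineMap_le_iff hP hε] at ht
    have hr : ∀ j, p < j → j ≤ q → reach P ε p q j ≤ projPos P p q q * t j := by
      intro j hj
      induction j, hj using Nat.le_induction with
      | base =>
        intro hq
        rw [reach_of_le le_rfl]
        exact mul_nonneg hW.le (t0 ▸ hm ⟨le_rfl, hpq.le⟩ ⟨by omega, hq⟩ (by omega))
      | succ j hj ih =>
        intro hq
        have : t j ≤ t (j + 1) := hm ⟨by omega, by omega⟩ ⟨by omega, hq⟩ (by omega)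
        have h2 : projPos P p q q * t j ≤ projPos P p q q * t (j + 1) := by gcongr
        rw [reach_succ hj]
        exact max_le ((ih (by omega)).trans h2) ((ht j ⟨by omega, by omega⟩).2.1.trans h2)
    refine ⟨fun j h1 h2 => ?_, ?_⟩
    · have := ht j ⟨h1.le, h2.le⟩
      exact ⟨this.1, (hr j h1 h2.le).trans this.2.2⟩
    · have := hr q hpq le_rfl
      rwa [t1, mul_one] at this
  · rintro ⟨h1, h2⟩
    have hr0 : ∀ j, 0 ≤ reach P ε p q j := fun j => by
      have := monotone_reach (P := P) (ε := ε) (p := p) (q := q) (Nat.zero_le j)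
      simpa [reach] using this
    refine ⟨fun j => if j < q then reach P ε p q (j + 1) / projPos P p q q else 1, ?_, ?_, by simp,
      ?_⟩
    · rintro i - j - hij
      dsimp only
      split_ifs with hi hj
      · have := monotone_reach (P := P) (ε := ε) (p := p) (q := q) (Nat.succ_le_succ hij)
        gcongr
      · rw [div_le_one hW]
        exact (monotone_reach (by omega)).trans h2
      · omega
      · exact le_rfl
    · dsimp only
      rw [if_pos hpq, reach_of_le le_rfl, zero_div]
    · rintro j ⟨hj1, hj2⟩
      dsimp only
      rcases hj2.eq_or_lt with rfl | hj2
      · simpa using hε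
      rcases hj1.eq_or_lt with rfl | hj1
      · rw [if_pos hpq, reach_of_le le_rfl, zero_div]
        simpa using hε
      · rw [if_pos hj2, dist_lineMap_le_iff hP hε, mul_div_cancel₀ _ hW.ne', reach_succ hj1]
        obtain ⟨h3, h4⟩ := h1 j hj1 hj2
        have := Real.sqrt_nonneg (chordSq P ε p q j)
        exact ⟨h3, le_max_right _ _, max_le h4 (by linarith)⟩

end Decision

/-- Comparison of the left end of one chord with the right end of another one without roots. -/
theorem sub_sqrt_le_add_sqrt_iff {u v D E : ℝ} (hD : 0 ≤ D) (hE : 0 ≤ E) :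
    u - √D ≤ v + √E ↔ u ≤ v ∨ (u - v) * (u - v) ≤ D + E ∨
      ((u - v) * (u - v) - (D + E)) * ((u - v) * (u - v) - (D + E)) ≤ 4 * (D * E) := by
  have hs := Real.sqrt_nonneg D
  have hr := Real.sqrt_nonneg E
  obtain ⟨a, ha, rfl⟩ : ∃ a, 0 ≤ a ∧ D = a ^ 2 := ⟨√D, hs, (Real.sq_sqrt hD).symm⟩
  obtain ⟨b, hb, rfl⟩ : ∃ b, 0 ≤ b ∧ E = b ^ 2 := ⟨√E, hr, (Real.sq_sqrt hE).symm⟩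
  rw [Real.sqrt_sq ha, Real.sqrt_sq hb]
  obtain ⟨d, hd⟩ : ∃ d, d = u - v := ⟨_, rfl⟩
  rw [← hd]
  have e1 : u - a ≤ v + b ↔ d ≤ a + b := by rw [hd]; constructor <;> intro h <;> linarith
  have e2 : u ≤ v ↔ d ≤ 0 := by rw [hd]; constructor <;> intro h <;> linarith
  rw [e1, e2]
  have hab := mul_nonneg ha hb
  constructor
  · intro h
    by_cases h0 : d ≤ 0
    · exact Or.inl h0
    by_cases h1 : d * d ≤ a ^ 2 + b ^ 2
    · exact Or.inr (Or.inl h1)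
    · refine Or.inr (Or.inr ?_)
      have h3 : d * d - (a ^ 2 + b ^ 2) ≤ 2 * (a * b) := by nlinarith
      nlinarith
  · rintro (h | h | h)
    · linarith
    · nlinarith
    · have h3 : d * d - (a ^ 2 + b ^ 2) ≤ 2 * (a * b) := by
        apply le_of_sq_le_sq _ (by linarith)
        nlinarith
      nlinarith

/-- Comparison of the left ends of two chords without roots. -/
theorem sub_sqrt_le_sub_sqrt_iff {u v D E : ℝ} (hD : 0 ≤ D) (hE : 0 ≤ E) :
    u - √D ≤ v - √E ↔
      (v ≤ u → 0 ≤ D - E - (u - v) * (u - v) ∧ 4 * ((u - v) * (u - v) * E) ≤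
        (D - E - (u - v) * (u - v)) * (D - E - (u - v) * (u - v))) ∧
      (u ≤ v → E - D ≤ (u - v) * (u - v) ∨
        (E - D - (u - v) * (u - v)) * (E - D - (u - v) * (u - v)) ≤
          4 * ((u - v) * (u - v) * D)) := by
  have hs := Real.sqrt_nonneg D
  have hr := Real.sqrt_nonneg E
  obtain ⟨a, ha, rfl⟩ : ∃ a, 0 ≤ a ∧ D = a ^ 2 := ⟨√D, hs, (Real.sq_sqrt hD).symm⟩
  obtain ⟨b, hb, rfl⟩ : ∃ b, 0 ≤ b ∧ E = b ^ 2 := ⟨√E, hr, (Real.sq_sqrt hE).symm⟩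
  rw [Real.sqrt_sq ha, Real.sqrt_sq hb]
  obtain ⟨d, hd⟩ : ∃ d, d = u - v := ⟨_, rfl⟩
  rw [← hd]
  have e1 : u - a ≤ v - b ↔ d + b ≤ a := by rw [hd]; constructor <;> intro h <;> linarith
  have e2 : u ≤ v ↔ d ≤ 0 := by rw [hd]; constructor <;> intro h <;> linarith
  have e3 : v ≤ u ↔ 0 ≤ d := by rw [hd]; constructor <;> intro h <;> linarith
  rw [e1, e2, e3]
  have h1 : 0 ≤ d → (d + b ≤ a ↔ 0 ≤ a ^ 2 - b ^ 2 - d * d ∧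
      4 * (d * d * b ^ 2) ≤ (a ^ 2 - b ^ 2 - d * d) * (a ^ 2 - b ^ 2 - d * d)) := by
    intro h0
    have hdb := mul_nonneg h0 hb
    constructor
    · intro h
      have h3 : 2 * (d * b) ≤ a ^ 2 - b ^ 2 - d * d := by nlinarith
      exact ⟨by linarith, by nlinarith⟩
    · rintro ⟨h4, h5⟩
      have h3 : 2 * (d * b) ≤ a ^ 2 - b ^ 2 - d * d := by
        apply le_of_sq_le_sq _ h4
        nlinarith
      nlinarith
  have h2 : d ≤ 0 → (d + b ≤ a ↔ b ^ 2 - a ^ 2 ≤ d * d ∨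
      (b ^ 2 - a ^ 2 - d * d) * (b ^ 2 - a ^ 2 - d * d) ≤ 4 * (d * d * a ^ 2)) := by
    intro h0
    have hda := mul_nonneg (neg_nonneg.2 h0) ha
    constructor
    · intro h
      by_cases h4 : b ^ 2 - a ^ 2 ≤ d * d
      · exact Or.inl h4
      · refine Or.inr ?_
        have h3 : b ^ 2 - a ^ 2 - d * d ≤ 2 * (-d * a) := by nlinarith
        nlinarith
    · rintro (h | h)
      · nlinarith
      · have h3 : b ^ 2 - a ^ 2 - d * d ≤ 2 * (-d * a) := by
          apply le_of_sq_le_sq _ (by linarith)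
          nlinarith
        nlinarith
  constructor
  · exact fun h => ⟨fun h0 => (h1 h0).1 h, fun h0 => (h2 h0).1 h⟩
  · rintro ⟨h3, h4⟩
    rcases le_total 0 d with h0 | h0
    · exact (h1 h0).2 (h3 h0)
    · exact (h2 h0).2 (h4 h0)

/-! ### Consecutive elements of a filtered list -/

theorem exists_of_pair_infix_filter {α : Type*} {p : α → Bool} {L : List α} {a b : α}
    (h : [a, b] <:+: L.filter p) :
    ∃ l₁ l₂ l₃, L = l₁ ++ a :: (l₂ ++ b :: l₃) ∧ ∀ x ∈ l₂, p x = false := by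
  obtain ⟨s, t, h⟩ := h
  rw [List.append_assoc, eq_comm, List.filter_eq_append_iff] at h
  obtain ⟨m₁, m₂, rfl, -, h⟩ := h
  rw [List.cons_append, List.filter_eq_cons_iff] at h
  obtain ⟨m₃, m₄, rfl, -, -, h⟩ := h
  rw [List.cons_append, List.filter_eq_cons_iff] at h
  obtain ⟨m₅, m₆, rfl, h5, -, -⟩ := h
  exact ⟨m₁ ++ m₃, m₅, m₆, by simp, fun x hx => by simpa using h5 x hx⟩

theorem pair_infix_filter {α : Type*} {p : α → Bool} {l₁ l₂ l₃ : List α} {a b : α}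
    (ha : p a = true) (hb : p b = true) (h : ∀ x ∈ l₂, p x = false) :
    [a, b] <:+: (l₁ ++ a :: (l₂ ++ b :: l₃)).filter p := by
  refine ⟨l₁.filter p, l₃.filter p, ?_⟩
  have : l₂.filter p = [] := List.filter_eq_nil_iff.2 fun x hx => by simp [h x hx]
  simp [List.filter_append, ha, hb, this]

/-! ### Positions in the concatenated polylines -/

theorem List.getElem?_flatten_of_lt {α : Type*} (Ls : List (List α)) {i j : ℕ} (hi : i < Ls.length)
    (hj : j < Ls[i].length) :
    Ls.flatten[((Ls.take i).map List.length).sum + j]? = some Ls[i][j] := by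
  induction Ls generalizing i with
  | nil => simp at hi
  | cons L Ls ih =>
    cases i with
    | zero =>
      simp only [List.getElem_cons_zero] at hj
      simp [List.getElem?_append_left hj]
    | succ i =>
      simp only [List.getElem_cons_succ, List.length_cons, Nat.add_lt_add_iff_right] at hi hj
      rw [List.flatten_cons, List.take_succ_cons, List.map_cons, List.sum_cons,
        List.getElem?_append_right (by omega), Nat.add_assoc, Nat.add_sub_cancel_left, ih hi hj]
      rfl

theorem isShortcut_shift {P Q : ℕ → Plane} {ε : ℝ} {c k : ℕ} (h : ∀ j ≤ k, P j = Q (c + j)) :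
    IsShortcut P ε 0 k ↔ IsShortcut Q ε c (c + k) := by
  constructor
  · rintro ⟨t, hm, t0, t1, ht⟩
    refine ⟨fun j => t (j - c), ?_, by simpa using t0, by simpa using t1, ?_⟩
    · rintro i ⟨hi, hi'⟩ j ⟨hj, hj'⟩ hij
      exact hm ⟨by omega, by omega⟩ ⟨by omega, by omega⟩ (by omega)
    · rintro j ⟨hj, hj'⟩
      have := ht (j - c) ⟨by omega, by omega⟩
      rwa [h 0 (by omega), h k le_rfl, h (j - c) (by omega), Nat.add_zero,
        show c + (j - c) = j by omega] at this
  · rintro ⟨t, hm, t0, t1, ht⟩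
    refine ⟨fun j => t (c + j), ?_, by simpa using t0, by simpa using t1, ?_⟩
    · rintro i ⟨hi, hi'⟩ j ⟨hj, hj'⟩ hij
      exact hm ⟨by omega, by omega⟩ ⟨by omega, by omega⟩ (by omega)
    · rintro j ⟨hj, hj'⟩
      rw [h 0 (by omega), h k le_rfl, h j hj', Nat.add_zero]
      exact ht (c + j) ⟨by omega, by omega⟩

namespace PBSInstance

variable (I : PBSInstance)

/-- The index of the bend at a position of the concatenated polylines. -/
def bendAt (x : ℕ) : ℕ := I.lineData.getD x 0

/-- The point at a position of the concatenated polylines. -/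
noncomputable def pointAt (x : ℕ) : Plane :=
  if h : I.bendAt x < I.n then I.bend ⟨I.bendAt x, h⟩ else 0

/-- In `lineData` the coercion to natural numbers is elaborated as a monadic map. -/
theorem lineData_eq : I.lineData = (List.ofFn I.line).flatten.map Fin.val := by
  unfold lineData
  rw [List.map_id', List.bind_eq_flatMap]
  simp only [List.pure_def, List.map_eq_flatMap]

theorem lineStart_succ (i : Fin I.ℓ) :
    I.lineStart (i + 1) = I.lineStart i + (I.line i).length := by
  unfold lineStart
  rw [List.take_succ_eq_append_getElem (by simp), List.map_append, List.sum_append]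
  simp

theorem bendAt_add (i : Fin I.ℓ) {j : ℕ} (hj : j < (I.line i).length) :
    I.bendAt (I.lineStart i + j) = (I.line i)[j] := by
  have hlen : (i : ℕ) < (List.ofFn I.line).length := by simp
  have := List.getElem?_flatten_of_lt (List.ofFn I.line) hlen (j := j) (by simpa using hj)
  unfold bendAt lineStart
  rw [lineData_eq, List.getD_eq_getElem?_getD, List.getElem?_map, this]
  simp

theorem pointAt_add (i : Fin I.ℓ) {j : ℕ} (hj : j < (I.line i).length) :
    I.pointAt (I.lineStart i + j) = I.bend (I.line i)[j] := by
  unfold pointAt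
  simp only [I.bendAt_add i hj, Fin.is_lt, dite_true, Fin.eta]

theorem length_line_pos (i : Fin I.ℓ) : 0 < (I.line i).length :=
  List.length_pos_iff.2 (I.line_ne_nil i)

theorem length_line_le (i : Fin I.ℓ) : (I.line i).length ≤ I.n := by
  simpa using (I.line_nodup i).length_le_card

theorem n_pos : 0 < I.n :=
  (I.length_line_pos ⟨0, I.ℓ_pos⟩).trans_le (I.length_line_le _)

theorem lineStart_zero : I.lineStart 0 = 0 := by simp [lineStart]

theorem lineStart_le (i : ℕ) (hi : i ≤ I.ℓ) : I.lineStart i ≤ i * I.n := by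
  induction i with
  | zero => simp [lineStart]
  | succ i ih =>
    have h1 := I.lineStart_succ ⟨i, hi⟩
    have h2 := I.length_line_le ⟨i, hi⟩
    have h3 := ih (by omega)
    dsimp only at h1
    rw [h1, Nat.succ_mul]
    omega

theorem exists_line_of_lt {m x : ℕ} (hm : m ≤ I.ℓ) (hx : x < I.lineStart m) :
    ∃ i : Fin I.ℓ, I.lineStart i ≤ x ∧ x < I.lineStart (i + 1) := by
  induction m with
  | zero => simp [lineStart] at hx
  | succ m ih =>
    by_cases h : x < I.lineStart m
    · exact ih (by omega) h
    · exact ⟨⟨m, hm⟩, not_lt.1 h, hx⟩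

theorem bendAt_lt (i : Fin I.ℓ) {x : ℕ} (h1 : I.lineStart i ≤ x) (h2 : x < I.lineStart (i + 1)) :
    I.bendAt x < I.n := by
  rw [I.lineStart_succ] at h2
  obtain ⟨j, rfl⟩ := Nat.exists_eq_add_of_le h1
  rw [I.bendAt_add i (by omega)]
  exact Fin.is_lt _

theorem bendAt_inj (i : Fin I.ℓ) {x y : ℕ} (hx1 : I.lineStart i ≤ x)
    (hx2 : x < I.lineStart (i + 1)) (hy1 : I.lineStart i ≤ y) (hy2 : y < I.lineStart (i + 1))
    (h : I.bendAt x = I.bendAt y) : x = y := by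
  rw [I.lineStart_succ] at hx2 hy2
  obtain ⟨j, rfl⟩ := Nat.exists_eq_add_of_le hx1
  obtain ⟨k, rfl⟩ := Nat.exists_eq_add_of_le hy1
  rw [I.bendAt_add i (by omega), I.bendAt_add i (by omega), Fin.val_inj,
    (I.line_nodup i).getElem_inj_iff] at h
  rw [h]

theorem pointAt_eq (i : Fin I.ℓ) {x : ℕ} (h1 : I.lineStart i ≤ x)
    (h2 : x < I.lineStart (i + 1)) : I.pointAt x = I.bend ⟨I.bendAt x, I.bendAt_lt i h1 h2⟩ := by
  rw [pointAt, dif_pos (I.bendAt_lt i h1 h2)]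

theorem pointAt_ne (i : Fin I.ℓ) {x y : ℕ} (h1 : I.lineStart i ≤ x) (hxy : x < y)
    (h2 : y < I.lineStart (i + 1)) : I.pointAt x ≠ I.pointAt y := by
  rw [I.pointAt_eq i h1 (by omega), I.pointAt_eq i (by omega) h2]
  intro h
  have := I.bend_injective h
  rw [Fin.mk.injEq] at this
  exact hxy.ne (I.bendAt_inj i h1 (by omega) (by omega) h2 this)

/-- The error condition for a segment of a simplification, in terms of positions. -/
theorem frechetDist_subPolyline_le_iff (i : Fin I.ℓ) {c d : ℕ} (hcd : c < d)
    (hd : d < (I.line i).length) {ε : ℝ} :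
    frechetDist ([(I.line i)[c], (I.line i)[d]].map I.bend)
      ((subPolyline (I.line i) (I.line i)[c] (I.line i)[d]).map I.bend) ≤ ε ↔
    IsShortcut I.pointAt ε (I.lineStart i + c) (I.lineStart i + d) := by
  obtain ⟨k, rfl⟩ := Nat.exists_eq_add_of_lt hcd
  set L := (subPolyline (I.line i) (I.line i)[c] (I.line i)[c + k + 1]).map I.bend with hL
  have hsub : L = (((I.line i).drop c).take (k + 2)).map I.bend := by
    rw [hL, subPolyline, (I.line_nodup i).idxOf_getElem c (by omega),
      (I.line_nodup i).idxOf_getElem (c + k + 1) hd]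
    congr 2
    omega
  have hlen : L.length = (k + 1) + 1 := by
    rw [hsub]
    simp
    omega
  have hget : ∀ j ≤ k + 1, L.getD j 0 = I.pointAt (I.lineStart i + c + j) := by
    intro j hj
    rw [Nat.add_assoc, I.pointAt_add i (by omega), List.getD_eq_getElem _ _ (by omega)]
    simp [hsub]
  have e0 : I.bend (I.line i)[c] = L.getD 0 0 := by
    rw [hget 0 (by omega), Nat.add_zero, I.pointAt_add i (by omega)]
  have e1 : I.bend (I.line i)[c + k + 1] = L.getD (k + 1) 0 := by
    rw [hget (k + 1) le_rfl, show I.lineStart i + c + (k + 1) = I.lineStart i + (c + k + 1) by omega,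
      I.pointAt_add i hd]
  rw [List.map_cons, List.map_cons, List.map_nil, e0, e1,
    show I.lineStart i + (c + k + 1) = I.lineStart i + c + (k + 1) by omega, ← isShortcut_shift hget]
  exact ⟨isShortcut_of_frechetDist_le (by omega) hlen, frechetDist_le_of_isShortcut (by omega) hlen⟩

variable {I}

/-- A simplification retains a bend strictly between any two positions whose segment has error more
than twice the permitted one, as otherwise that segment would shorten a segment of the
simplification. -/
theorem IsSimplification.exists_between {ε : ℝ} {S : Finset (Fin I.n)} (h : I.IsSimplification ε S)
    (i : Fin I.ℓ) {p q : ℕ} (hp : I.lineStart i ≤ p) (hpq : p < q)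
    (hq : q < I.lineStart (i + 1)) (hbad : ¬ IsShortcut I.pointAt (2 * ε) p q) :
    ∃ x, p < x ∧ x < q ∧ ∃ v ∈ S, (v : ℕ) = I.bendAt x := by
  by_contra hno
  obtain ⟨hhead, hlast, hseg⟩ := h i
  rw [I.lineStart_succ] at hq
  obtain ⟨c, rfl⟩ := Nat.exists_eq_add_of_le hp
  obtain ⟨d, rfl⟩ := Nat.exists_eq_add_of_le (hp.trans hpq.le)
  have hcd : c < d := by omega
  have hd : d < (I.line i).length := by omega
  have hlen := I.length_line_pos i
  set L := I.line i with hL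
  -- `a` is the last retained index up to `c`, and `b` the first one from `d` on.
  obtain ⟨a, ⟨hac, haS⟩, hamax⟩ : ∃ a, (a ≤ c ∧ ∃ h : a < L.length, L[a] ∈ S) ∧
      ∀ y, a < y → y ≤ c → ∀ h : y < L.length, L[y] ∉ S := by
    have hex : ∃ y, ∃ a, a + y = c ∧ ∃ h : a < L.length, L[a] ∈ S := by
      refine ⟨c, 0, by omega, hlen, ?_⟩
      have := (List.mem_filter.1 hhead).2
      rw [List.head_eq_getElem] at this
      simpa using this
    classical
    obtain ⟨a, ha, haS⟩ := Nat.find_spec hex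
    refine ⟨a, ⟨by omega, haS⟩, fun y h1 h2 h3 h4 => ?_⟩
    exact Nat.find_min hex (m := c - y) (by omega) ⟨y, by omega, h3, h4⟩
  obtain ⟨b, ⟨hdb, hb, hbS⟩, hbmin⟩ : ∃ b, (d ≤ b ∧ ∃ h : b < L.length, L[b] ∈ S) ∧
      ∀ y, d ≤ y → y < b → ∀ h : y < L.length, L[y] ∉ S := by
    have hex : ∃ b, d ≤ b ∧ ∃ h : b < L.length, L[b] ∈ S := by
      refine ⟨L.length - 1, by omega, by omega, ?_⟩
      have := (List.mem_filter.1 hlast).2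
      rw [List.getLast_eq_getElem] at this
      simpa using this
    classical
    refine ⟨Nat.find hex, Nat.find_spec hex, fun y h1 h2 h3 h4 => ?_⟩
    exact Nat.find_min hex h2 ⟨h1, h3, h4⟩
  obtain ⟨ha, haS⟩ := haS
  have hmid : ∀ y, a < y → y < b → ∀ h : y < L.length, L[y] ∉ S := by
    intro y h1 h2 h3 h4
    rcases le_or_gt y c with h5 | h5
    · exact hamax y h1 h5 h3 h4
    rcases le_or_gt d y with h6 | h6
    · exact hbmin y h6 h2 h3 h4
    · exact hno ⟨I.lineStart i + y, by omega, by omega, _, h4, (I.bendAt_add i h3).symm⟩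
  have hsplit : L = L.take a ++ L[a] :: ((L.drop (a + 1)).take (b - (a + 1)) ++
      L[b] :: L.drop (b + 1)) := by
    have e1 : L[b] :: L.drop (b + 1) = (L.drop (a + 1)).drop (b - (a + 1)) := by
      rw [List.drop_drop, show a + 1 + (b - (a + 1)) = b by omega, List.drop_eq_getElem_cons hb]
    rw [e1, List.take_append_drop, ← List.drop_eq_getElem_cons ha, List.take_append_drop]
  have hinf : [L[a], L[b]] <:+: I.induced S i := by
    have := pair_infix_filter (p := fun v => decide (v ∈ S)) (l₁ := L.take a) (a := L[a])
      (l₂ := (L.drop (a + 1)).take (b - (a + 1))) (b := L[b]) (l₃ := L.drop (b + 1))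
      (by simpa using haS) (by simpa using hbS) (by
        intro x hx
        obtain ⟨y, hy, rfl⟩ := List.mem_iff_getElem.1 hx
        simp only [List.length_take, List.length_drop] at hy
        rw [List.getElem_take, List.getElem_drop]
        simpa using hmid (a + 1 + y) (by omega) (by omega) (by omega))
    rwa [← hsplit] at this
  have := (I.frechetDist_subPolyline_le_iff i (show a < b by omega) hb).1 (hseg _ _ hinf)
  exact hbad (this.sub (by omega) (by omega) (by omega))

theorem isSimplification_of_isShortcut {ε : ℝ} {S : Finset (Fin I.n)}
    (hhead : ∀ i, (I.line i).head (I.line_ne_nil i) ∈ S)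
    (hlast : ∀ i, (I.line i).getLast (I.line_ne_nil i) ∈ S)
    (h : ∀ (i : Fin I.ℓ) (p q : ℕ), I.lineStart i ≤ p → p < q → q < I.lineStart (i + 1) →
      (¬ ∃ x, p < x ∧ x < q ∧ ∃ v ∈ S, (v : ℕ) = I.bendAt x) → IsShortcut I.pointAt ε p q) :
    I.IsSimplification ε S := by
  intro i
  refine ⟨List.mem_filter.2 ⟨List.head_mem _, by simpa using hhead i⟩,
    List.mem_filter.2 ⟨List.getLast_mem _, by simpa using hlast i⟩, fun a b hab => ?_⟩
  obtain ⟨l₁, l₂, l₃, hL, hl⟩ := exists_of_pair_infix_filter hab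
  have hlen : (I.line i).length = l₁.length + (l₂.length + (l₃.length + 1) + 1) := by
    rw [hL]
    simp
  have hb : l₁.length + l₂.length + 1 < (I.line i).length := by omega
  have ea : (I.line i)[l₁.length] = a := by simp [hL]
  have eb : (I.line i)[l₁.length + l₂.length + 1] = b := by
    simp only [hL]
    rw [List.getElem_append_right (by omega)]
    simp [show l₁.length + l₂.length + 1 - l₁.length = l₂.length + 1 by omega]
  rw [← ea, ← eb, I.frechetDist_subPolyline_le_iff i (by omega) hb]
  refine h i _ _ (by omega) (by omega) (by rw [I.lineStart_succ]; omega) ?_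
  rintro ⟨x, h1, h2, v, hv, hvx⟩
  obtain ⟨y, rfl⟩ := Nat.exists_eq_add_of_le (show I.lineStart i + l₁.length + 1 ≤ x from h1)
  have hy : y < l₂.length := by omega
  rw [show I.lineStart i + l₁.length + 1 + y = I.lineStart i + (l₁.length + 1 + y) by omega,
    I.bendAt_add i (by omega), Fin.val_inj] at hvx
  have ey : (I.line i)[l₁.length + 1 + y] = l₂[y] := by
    simp only [hL]
    rw [List.getElem_append_right (by omega)]
    simp only [show l₁.length + 1 + y - l₁.length = y + 1 by omega, List.getElem_cons_succ]
    rw [List.getElem_append_left hy]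
  have := hl _ (List.getElem_mem hy)
  rw [← ey, ← hvx] at this
  simp [hv] at this

end PBSInstance

/-! ### Reasoning about programs -/

namespace RealRAM

@[simp] theorem State.nstore_nat (s : State) (a j v b k : ℕ) :
    (s.nstore a j v).nat b k = if b = a ∧ k = j then v else s.nat b k := by
  unfold State.nstore
  by_cases hb : b = a
  · subst hb
    by_cases hk : k = j
    · subst hk; simp
    · simp [hk]
  · simp [hb]

@[simp] theorem State.nstore_real (s : State) (a j v : ℕ) : (s.nstore a j v).real = s.real := rfl

@[simp] theorem State.rstore_real (s : State) (a j : ℕ) (v : ℝ) (b k : ℕ) :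
    (s.rstore a j v).real b k = if b = a ∧ k = j then v else s.real b k := by
  unfold State.rstore
  by_cases hb : b = a
  · subst hb
    by_cases hk : k = j
    · subst hk; simp
    · simp [hk]
  · simp [hb]

@[simp] theorem State.rstore_nat (s : State) (a j : ℕ) (v : ℝ) : (s.rstore a j v).nat = s.nat := rfl

/-- Total correctness with a time bound: `c`, started in `s`, halts after at most `B` steps in a
memory with property `Q`. -/
def Ensures (c : Program) (s : State) (B : ℕ) (Q : State → Prop) : Prop :=
  ∃ t s', Runs c s t s' ∧ t ≤ B ∧ Q s'

/-- Programs without loops. -/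
def Program.LoopFree : Program → Prop
  | .skip => True
  | .nset _ _ _ => True
  | .rset _ _ _ => True
  | .seq c d => c.LoopFree ∧ d.LoopFree
  | .branch _ c d => c.LoopFree ∧ d.LoopFree
  | .loop _ _ => False

open Classical in
/-- The effect of a program without loops. -/
noncomputable def Program.exec : Program → State → State
  | .skip, s => s
  | .nset a i e, s => s.nstore a (i.val s) (e.val s)
  | .rset a i e, s => s.rstore a (i.val s) (e.val s)
  | .seq c d, s => d.exec (c.exec s)
  | .branch p c d, s => if p.Holds s then c.exec s else d.exec s
  | .loop _ _, s => s

theorem Program.exec_skip (s : State) : Program.skip.exec s = s := rfl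

theorem Program.exec_nset (s : State) (a : ℕ) (i e : NExp) :
    (Program.nset a i e).exec s = s.nstore a (i.val s) (e.val s) := rfl

theorem Program.exec_rset (s : State) (a : ℕ) (i : NExp) (e : RExp) :
    (Program.rset a i e).exec s = s.rstore a (i.val s) (e.val s) := rfl

theorem Program.exec_seq (s : State) (c d : Program) :
    (Program.seq c d).exec s = d.exec (c.exec s) := rfl

theorem Program.exec_branch_true {s : State} {p : Test} (hp : p.Holds s) (c d : Program) :
    (Program.branch p c d).exec s = c.exec s := if_pos hp

theorem Program.exec_branch_false {s : State} {p : Test} (hp : ¬ p.Holds s) (c d : Program) :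
    (Program.branch p c d).exec s = d.exec s := if_neg hp

/-- An upper bound for the running time of a program without loops. -/
def Program.maxCost : Program → ℕ
  | .skip => 1
  | .nset _ i e => i.cost + e.cost + 1
  | .rset _ i e => i.cost + e.cost + 1
  | .seq c d => c.maxCost + d.maxCost
  | .branch p c d => p.cost + (c.maxCost + d.maxCost)
  | .loop p _ => p.cost

theorem Program.LoopFree.runs {c : Program} (hc : c.LoopFree) (s : State) :
    ∃ t ≤ c.maxCost, Runs c s t (c.exec s) := by
  induction c generalizing s with
  | skip => exact ⟨1, le_rfl, .skip s⟩
  | nset a i e => exact ⟨_, le_rfl, .nset s a i e⟩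
  | rset a i e => exact ⟨_, le_rfl, .rset s a i e⟩
  | seq c d ihc ihd =>
    obtain ⟨t, ht, hr⟩ := ihc hc.1 s
    obtain ⟨u, hu, hr'⟩ := ihd hc.2 (c.exec s)
    exact ⟨t + u, add_le_add ht hu, .seq hr hr'⟩
  | branch p c d ihc ihd =>
    unfold Program.exec Program.maxCost
    split_ifs with hp
    · obtain ⟨t, ht, hr⟩ := ihc hc.1 s
      exact ⟨p.cost + t, by omega, .branch_true hp hr⟩
    · obtain ⟨t, ht, hr⟩ := ihd hc.2 s
      exact ⟨p.cost + t, by omega, .branch_false hp hr⟩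
  | loop p c => exact hc.elim

theorem Ensures.mono {c : Program} {s : State} {B B' : ℕ} {Q Q' : State → Prop}
    (h : Ensures c s B Q) (hB : B ≤ B') (hQ : ∀ s', Q s' → Q' s') : Ensures c s B' Q' := by
  obtain ⟨t, s', hr, ht, hs⟩ := h
  exact ⟨t, s', hr, ht.trans hB, hQ s' hs⟩

theorem Ensures.of_exec {c : Program} (hc : c.LoopFree) {s : State} {B : ℕ} {Q : State → Prop}
    (hB : c.maxCost ≤ B) (hQ : Q (c.exec s)) : Ensures c s B Q := by
  obtain ⟨t, ht, hr⟩ := hc.runs s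
  exact ⟨t, _, hr, ht.trans hB, hQ⟩

theorem Ensures.seq {c d : Program} {s : State} {B₁ B₂ : ℕ} {R Q : State → Prop}
    (hc : Ensures c s B₁ R) (hd : ∀ s', R s' → Ensures d s' B₂ Q) :
    Ensures (.seq c d) s (B₁ + B₂) Q := by
  obtain ⟨t, s', hr, ht, hs⟩ := hc
  obtain ⟨u, s'', hr', hu, hs'⟩ := hd s' hs
  exact ⟨t + u, s'', .seq hr hr', add_le_add ht hu, hs'⟩

theorem Ensures.seq_exec {c d : Program} (hc : c.LoopFree) {s : State} {B : ℕ} {Q : State → Prop}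
    (hd : Ensures d (c.exec s) B Q) : Ensures (.seq c d) s (c.maxCost + B) Q :=
  (Ensures.of_exec hc le_rfl rfl).seq fun _ hs => hs ▸ hd

theorem Ensures.branch {p : Test} {c d : Program} {s : State} {B : ℕ} {Q : State → Prop}
    (hc : p.Holds s → Ensures c s B Q) (hd : ¬ p.Holds s → Ensures d s B Q) :
    Ensures (.branch p c d) s (p.cost + B) Q := by
  by_cases hp : p.Holds s
  · obtain ⟨t, s', hr, ht, hs⟩ := hc hp
    exact ⟨_, s', .branch_true hp hr, by omega, hs⟩
  · obtain ⟨t, s', hr, ht, hs⟩ := hd hp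
    exact ⟨_, s', .branch_false hp hr, by omega, hs⟩

/-- The scalar natural-number variable `a`. -/
abbrev nvar (a : ℕ) : NExp := .read a (.lit 0)

/-- The scalar real variable `a`. -/
abbrev rvar (a : ℕ) : RExp := .read a (.lit 0)

/-- The loop `for x = lo, …, hi - 1 do c`; the bound `hi` is evaluated before each pass. -/
def forLoop (x : ℕ) (lo hi : NExp) (c : Program) : Program :=
  .seq (.nset x (.lit 0) lo)
    (.loop (.neg (.nle hi (nvar x))) (.seq c (.nset x (.lit 0) (.add (nvar x) (.lit 1)))))

/-- The rule for counting loops, with an invariant that does not speak about the loop variable. -/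
theorem Ensures.forLoop {x : ℕ} {lo hi : NExp} {c : Program} {s : State} {l h B : ℕ}
    {Q : State → Prop} (Inv : ℕ → State → Prop) (hl : lo.val s = l)
    (h0 : Inv l s) (hst : ∀ k s v, Inv k s → Inv k (s.nstore x 0 v))
    (hhi : ∀ k s, Inv k s → hi.val s = h)
    (hc : ∀ k s, l ≤ k → k < h → Inv k s → s.nat x 0 = k →
      Ensures c s B (fun s' => Inv (k + 1) s' ∧ s'.nat x 0 = k))
    (hQ : ∀ s, Inv (max l h) s → Q s) :
    Ensures (forLoop x lo hi c) s (lo.cost + hi.cost + 6 + (h - l) * (B + hi.cost + 10)) Q := by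
  have main : ∀ (m k : ℕ) (s : State), l ≤ k → m = h - k → k ≤ max l h → Inv k s →
      s.nat x 0 = k → Ensures (.loop (.neg (.nle hi (nvar x)))
        (.seq c (.nset x (.lit 0) (.add (nvar x) (.lit 1))))) s
        (hi.cost + 4 + m * (B + hi.cost + 10)) (Inv (max l h)) := by
    intro m
    induction m with
    | zero =>
      intro k s hlk hm hk hI hx
      have hkh : k = max l h := by omega
      refine ⟨_, s, .loop_done ?_, ?_, hkh ▸ hI⟩
      · simp only [Test.Holds, NExp.val, hhi k s hI, hx, not_not]
        omega
      · simp [Test.cost, NExp.cost]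
    | succ m ih =>
      intro k s hlk hm hk hI hx
      obtain ⟨t, s', hr, ht, hI', hx'⟩ := hc k s hlk (by omega) hI hx
      obtain ⟨u, s'', hr', hu, hQ'⟩ := ih (k + 1) (s'.nstore x 0 (k + 1)) (by omega) (by omega)
        (by omega) (hst _ _ _ hI') (by simp)
      have hinc := Runs.nset s' x (.lit 0) (.add (nvar x) (.lit 1))
      simp only [NExp.val, hx', NExp.cost] at hinc
      refine ⟨_, s'', .loop_step ?_ (.seq hr hinc) hr', ?_, hQ'⟩
      · simp only [Test.Holds, NExp.val, hhi k s hI, hx]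
        omega
      · simp only [Test.cost, NExp.cost, Nat.succ_mul]
        omega
  obtain ⟨t, s', hr, ht, hI⟩ := main (h - l) l (s.nstore x 0 l) le_rfl rfl (le_max_left _ _)
    (hst _ _ _ h0) (by simp)
  have hinit := Runs.nset s x (.lit 0) lo
  simp only [hl, NExp.val] at hinit
  refine ⟨_, s', .seq hinit hr, ?_, hQ _ hI⟩
  simp only [NExp.cost]
  omega

/-- The memory `s'` differs from `s` only in the natural-number arrays `ns` and the real arrays
`rs`. -/
def Frame (ns rs : List ℕ) (s s' : State) : Prop :=
  (∀ a, a ∉ ns → s'.nat a = s.nat a) ∧ ∀ a, a ∉ rs → s'.real a = s.real a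

theorem Frame.refl (ns rs : List ℕ) (s : State) : Frame ns rs s s := ⟨fun _ _ => rfl, fun _ _ => rfl⟩

theorem Frame.trans {ns rs : List ℕ} {s s' s'' : State} (h : Frame ns rs s s')
    (h' : Frame ns rs s' s'') : Frame ns rs s s'' :=
  ⟨fun a ha => (h'.1 a ha).trans (h.1 a ha), fun a ha => (h'.2 a ha).trans (h.2 a ha)⟩

theorem Frame.mono {ns rs ns' rs' : List ℕ} {s s' : State} (h : Frame ns rs s s')
    (hn : ns ⊆ ns') (hr : rs ⊆ rs') : Frame ns' rs' s s' :=
  ⟨fun a ha => h.1 a fun h' => ha (hn h'), fun a ha => h.2 a fun h' => ha (hr h')⟩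

theorem Frame.nstore {ns rs : List ℕ} {s s' : State} (h : Frame ns rs s s') {a : ℕ} (ha : a ∈ ns)
    (j v : ℕ) : Frame ns rs s (s'.nstore a j v) := by
  refine ⟨fun b hb => ?_, h.2⟩
  rw [← h.1 b hb]
  exact Function.update_of_ne (fun hba : b = a => hb (hba ▸ ha)) _ _

theorem Frame.rstore {ns rs : List ℕ} {s s' : State} (h : Frame ns rs s s') {a : ℕ} (ha : a ∈ rs)
    (j : ℕ) (v : ℝ) : Frame ns rs s (s'.rstore a j v) := by
  refine ⟨h.1, fun b hb => ?_⟩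
  rw [← h.2 b hb]
  exact Function.update_of_ne (fun hba : b = a => hb (hba ▸ ha)) _ _

end RealRAM

namespace PBSInstance

open RealRAM

variable {I : PBSInstance}

/-- The memory still holds the input. -/
def HoldsInput (I : PBSInstance) (s : State) : Prop :=
  (∀ a < 4, s.nat a = I.input.nat a) ∧ ∀ a < 3, s.real a = I.input.real a

theorem HoldsInput.frame {ns rs : List ℕ} {s s' : State} (h : I.HoldsInput s)
    (hf : Frame ns rs s s') (hn : ∀ a ∈ ns, 4 ≤ a) (hr : ∀ a ∈ rs, 3 ≤ a) : I.HoldsInput s' :=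
  ⟨fun a ha => (hf.1 a fun h' => absurd (hn a h') (by omega)).trans (h.1 a ha),
    fun a ha => (hf.2 a fun h' => absurd (hr a h') (by omega)).trans (h.2 a ha)⟩

theorem HoldsInput.n_eq {s : State} (h : I.HoldsInput s) : s.nat 0 0 = I.n := by
  rw [h.1 0 (by omega)]; rfl

theorem HoldsInput.ℓ_eq {s : State} (h : I.HoldsInput s) : s.nat 1 0 = I.ℓ := by
  rw [h.1 1 (by omega)]; rfl

theorem HoldsInput.lineStart_eq {s : State} (h : I.HoldsInput s) {i : ℕ} (hi : i ≤ I.ℓ) :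
    s.nat 2 i = I.lineStart i := by
  rw [h.1 2 (by omega)]
  exact if_pos hi

theorem HoldsInput.bendAt_eq {s : State} (h : I.HoldsInput s) (x : ℕ) :
    s.nat 3 x = I.bendAt x := by
  rw [h.1 3 (by omega)]; rfl

theorem HoldsInput.δ_eq {s : State} (h : I.HoldsInput s) : s.real 2 0 = I.δ := by
  rw [h.2 2 (by omega)]; rfl

theorem HoldsInput.pointAt_zero {s : State} (h : I.HoldsInput s) (x : ℕ) :
    s.real 0 (s.nat 3 x) = I.pointAt x 0 := by
  rw [h.2 0 (by omega), h.bendAt_eq, pointAt]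
  simp only [input]
  split_ifs <;> rfl

theorem HoldsInput.pointAt_one {s : State} (h : I.HoldsInput s) (x : ℕ) :
    s.real 1 (s.nat 3 x) = I.pointAt x 1 := by
  rw [h.2 1 (by omega), h.bendAt_eq, pointAt]
  simp only [input]
  split_ifs <;> rfl

end PBSInstance

/-! ### The program that tests a pair of positions -/

namespace RealRAM

open PBSInstance

/-- The test `p` or `q`. -/
def Test.disj (p q : Test) : Test := .neg (.conj (.neg p) (.neg q))

@[simp] theorem Test.holds_disj {p q : Test} {s : State} :
    (p.disj q).Holds s ↔ p.Holds s ∨ q.Holds s := by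
  simp only [Test.disj, Test.Holds]
  tauto

/-- The test `u - √D ≤ v + √E`. -/
def leftLeRight (u D v E : RExp) : Test :=
  let d := RExp.sub u v
  let e := RExp.sub (.mul d d) (.add D E)
  (Test.rle u v).disj ((Test.rle (.mul d d) (.add D E)).disj
    (.rle (.mul e e) (.mul (.lit 4) (.mul D E))))

/-- The test `u - √D ≤ v - √E`. -/
def leftLeLeft (u D v E : RExp) : Test :=
  let d := RExp.sub u v
  let e := RExp.sub (.sub D E) (.mul d d)
  let f := RExp.sub (.sub E D) (.mul d d)
  .conj
    ((Test.neg (.rle v u)).disj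
      (.conj (.rle (.lit 0) e) (.rle (.mul (.lit 4) (.mul (.mul d d) E)) (.mul e e))))
    ((Test.neg (.rle u v)).disj
      ((Test.rle (.sub E D) (.mul d d)).disj
        (.rle (.mul f f) (.mul (.lit 4) (.mul (.mul d d) D)))))

theorem leftLeRight_holds {u D v E : RExp} {s : State} (hD : 0 ≤ D.val s) (hE : 0 ≤ E.val s) :
    (leftLeRight u D v E).Holds s ↔ u.val s - √(D.val s) ≤ v.val s + √(E.val s) := by
  rw [sub_sqrt_le_add_sqrt_iff hD hE]
  simp [leftLeRight, Test.Holds, RExp.val]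

theorem leftLeLeft_holds {u D v E : RExp} {s : State} (hD : 0 ≤ D.val s) (hE : 0 ≤ E.val s) :
    (leftLeLeft u D v E).Holds s ↔ u.val s - √(D.val s) ≤ v.val s - √(E.val s) := by
  rw [sub_sqrt_le_sub_sqrt_iff hD hE]
  simp only [leftLeLeft, Test.Holds, Test.holds_disj, RExp.val, imp_iff_not_or, Nat.cast_zero,
    Nat.cast_ofNat]

/-- The difference of the coordinates number `a` of the points at the positions `e` and `f`. -/
def coordSub (a : ℕ) (e f : NExp) : RExp :=
  .sub (.read a (.read 3 e)) (.read a (.read 3 f))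

/-- Computes `projPos` at position `e` for the pair of positions in the variables `11` and `12`. -/
def projExp (e : NExp) : RExp :=
  .add (.mul (coordSub 0 e (nvar 11)) (coordSub 0 (nvar 12) (nvar 11)))
    (.mul (coordSub 1 e (nvar 11)) (coordSub 1 (nvar 12) (nvar 11)))

/-- Computes `projOff`. -/
def offExp (e : NExp) : RExp :=
  .sub (.mul (coordSub 0 e (nvar 11)) (coordSub 1 (nvar 12) (nvar 11)))
    (.mul (coordSub 1 e (nvar 11)) (coordSub 0 (nvar 12) (nvar 11)))

/-- Computes `chordSq` for discs of radius `2 δ`. -/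
def chordExp (e : NExp) : RExp :=
  .sub (.mul (.mul (.mul (.lit 2) (rvar 2)) (.mul (.lit 2) (rvar 2))) (projExp (nvar 12)))
    (.mul (offExp e) (offExp e))

theorem projExp_val {I : PBSInstance} {s : State} (hs : I.HoldsInput s) (e : NExp) :
    (projExp e).val s = projPos I.pointAt (s.nat 11 0) (s.nat 12 0) (e.val s) := by
  simp only [projExp, coordSub, RExp.val, NExp.val, hs.pointAt_zero, hs.pointAt_one, projPos]

theorem chordExp_val {I : PBSInstance} {s : State} (hs : I.HoldsInput s) (e : NExp) :
    (chordExp e).val s = chordSq I.pointAt (2 * I.δ) (s.nat 11 0) (s.nat 12 0) (e.val s) := by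
  simp only [chordExp, offExp, coordSub, RExp.val, projExp_val hs, NExp.val, hs.pointAt_zero,
    hs.pointAt_one, hs.δ_eq, chordSq, projOff, Nat.cast_ofNat]

/-- One step of the greedy traversal for the pair of positions in the variables `11` and `12`, at
the position in the variable `13`. The real variables `3` and `4` hold `u` and `D` such that
`u - √D` is the value of `reach`; the variable `14` is set to `0` once the traversal fails. -/
def traverseStep : Program :=
  .seq (.rset 5 (.lit 0) (projExp (nvar 13))) (.seq (.rset 6 (.lit 0) (chordExp (nvar 13)))
    (.branch (.conj (.rle (.lit 0) (rvar 6)) (leftLeRight (rvar 3) (rvar 4) (rvar 5) (rvar 6)))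
      (.branch (leftLeLeft (rvar 3) (rvar 4) (rvar 5) (rvar 6))
        (.seq (.rset 3 (.lit 0) (rvar 5)) (.rset 4 (.lit 0) (rvar 6))) .skip)
      (.nset 14 (.lit 0) (.lit 0))))

/-- Decides whether the pair of positions in the variables `11` and `12` is a shortcut and stores
the answer in the variable `14`. -/
def pairTest : Program :=
  .seq (.seq (.rset 3 (.lit 0) (.lit 0)) (.seq (.rset 4 (.lit 0) (.lit 0))
    (.nset 14 (.lit 0) (.lit 1))))
  (.seq (forLoop 13 (.add (nvar 11) (.lit 1)) (nvar 12) traverseStep)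
    (.branch (leftLeRight (rvar 3) (rvar 4) (projExp (nvar 12)) (.lit 0)) .skip
      (.nset 14 (.lit 0) (.lit 0))))

/-- What is known during the traversal before the position `k` is dealt with. -/
structure TraverseInv (I : PBSInstance) (p q k : ℕ) (s : State) : Prop where
  good_iff : s.nat 14 0 ≠ 0 ↔ ∀ j, p < j → j < k →
    0 ≤ chordSq I.pointAt (2 * I.δ) p q j ∧ reach I.pointAt (2 * I.δ) p q j ≤
      projPos I.pointAt p q j + √(chordSq I.pointAt (2 * I.δ) p q j)
  reach_eq : s.nat 14 0 ≠ 0 →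
    0 ≤ s.real 4 0 ∧ s.real 3 0 - √(s.real 4 0) = reach I.pointAt (2 * I.δ) p q k

theorem ensures_traverseStep {I : PBSInstance} {s : State} (hs : I.HoldsInput s) {p q k : ℕ}
    (hp : s.nat 11 0 = p) (hq : s.nat 12 0 = q) (hk : s.nat 13 0 = k) (hpk : p < k)
    (hI : TraverseInv I p q k s) :
    Ensures traverseStep s 1000 fun s' => Frame [14] [3, 4, 5, 6] s s' ∧
      TraverseInv I p q (k + 1) s' := by
  refine .of_exec (by simp [traverseStep, Program.LoopFree]) (by decide) ?_
  set s₁ := s.rstore 5 0 (projPos I.pointAt p q k) with h1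
  set s₂ := s₁.rstore 6 0 (chordSq I.pointAt (2 * I.δ) p q k) with h2
  have hs₁ : I.HoldsInput s₁ :=
    hs.frame (ns := []) (rs := [5]) ((Frame.refl _ _ s).rstore (by decide) _ _) (by decide)
      (by decide)
  have e1 : (projExp (nvar 13)).val s = projPos I.pointAt p q k := by
    rw [projExp_val hs, hp, hq]
    simp only [NExp.val, hk]
  have e2 : (chordExp (nvar 13)).val s₁ = chordSq I.pointAt (2 * I.δ) p q k := by
    rw [chordExp_val hs₁]
    simp only [NExp.val, h1, State.rstore_nat, hk, hp, hq]
  have hF : Frame [14] [3, 4, 5, 6] s s₂ :=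
    ((Frame.refl _ _ s).rstore (by decide) _ _).rstore (by decide) _ _
  have r3 : s₂.real 3 0 = s.real 3 0 := by simp [h1, h2]
  have r4 : s₂.real 4 0 = s.real 4 0 := by simp [h1, h2]
  have r5 : s₂.real 5 0 = projPos I.pointAt p q k := by simp [h1, h2]
  have r6 : s₂.real 6 0 = chordSq I.pointAt (2 * I.δ) p q k := by simp [h1, h2]
  have n14 : s₂.nat 14 0 = s.nat 14 0 := rfl
  simp only [traverseStep, Program.exec_seq, Program.exec_rset, NExp.val, e1, ← h1, e2, ← h2]
  obtain ⟨hgood, hreach⟩ := hI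
  have hcond : s.nat 14 0 ≠ 0 → ((Test.conj (.rle (.lit 0) (rvar 6))
      (leftLeRight (rvar 3) (rvar 4) (rvar 5) (rvar 6))).Holds s₂ ↔
      0 ≤ chordSq I.pointAt (2 * I.δ) p q k ∧ reach I.pointAt (2 * I.δ) p q k ≤
        projPos I.pointAt p q k + √(chordSq I.pointAt (2 * I.δ) p q k)) := by
    intro hok
    obtain ⟨h0, hr⟩ := hreach hok
    simp only [Test.Holds, RExp.val, NExp.val, r6, Nat.cast_zero]
    refine and_congr_right fun hc => ?_
    rw [leftLeRight_holds (by simpa only [RExp.val, NExp.val, r4] using h0)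
      (by simpa only [RExp.val, NExp.val, r6] using hc)]
    simp only [RExp.val, NExp.val, r3, r4, r5, r6, hr]
  have hstep : ∀ {A : ℕ → Prop}, (∀ j, p < j → j < k + 1 → A j) ↔
      (∀ j, p < j → j < k → A j) ∧ A k := by
    intro A
    refine ⟨fun h => ⟨fun j h1 h2 => h j h1 (by omega), h k hpk (by omega)⟩, ?_⟩
    rintro ⟨h, hk⟩ j h1 h2
    rcases Nat.lt_succ_iff_lt_or_eq.1 h2 with h3 | rfl
    · exact h j h1 h3
    · exact hk
  by_cases hC : (Test.conj (.rle (.lit 0) (rvar 6))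
      (leftLeRight (rvar 3) (rvar 4) (rvar 5) (rvar 6))).Holds s₂
  · rw [Program.exec_branch_true hC]
    by_cases hL : (leftLeLeft (rvar 3) (rvar 4) (rvar 5) (rvar 6)).Holds s₂
    · rw [Program.exec_branch_true hL]
      simp only [Program.exec_seq, Program.exec_rset, NExp.val, RExp.val]
      refine ⟨(hF.rstore (by decide) _ _).rstore (by decide) _ _, ?_, ?_⟩
      · simp only [State.rstore_nat, n14, hstep, ← hgood]
        exact ⟨fun h => ⟨h, (hcond h).1 hC⟩, And.left⟩
      · intro hok
        simp only [State.rstore_nat, n14] at hok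
        have hc := (hcond hok).1 hC
        obtain ⟨h0, hr⟩ := hreach hok
        rw [leftLeLeft_holds (by simpa only [RExp.val, NExp.val, r4] using h0)
          (by simpa only [RExp.val, NExp.val, r6] using hc.1)] at hL
        simp only [RExp.val, NExp.val, r3, r4, r5, r6, hr] at hL
        simp only [State.rstore_real, r5, r6]
        refine ⟨by simpa [r6] using hc.1, ?_⟩
        rw [reach_succ hpk, max_eq_right hL]
        simp
    · rw [Program.exec_branch_false hL, Program.exec_skip]
      refine ⟨hF, ?_, ?_⟩
      · simp only [n14, hstep, ← hgood]
        exact ⟨fun h => ⟨h, (hcond h).1 hC⟩, And.left⟩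
      · intro hok
        rw [n14] at hok
        have hc := (hcond hok).1 hC
        obtain ⟨h0, hr⟩ := hreach hok
        rw [leftLeLeft_holds (by simpa only [RExp.val, NExp.val, r4] using h0)
          (by simpa only [RExp.val, NExp.val, r6] using hc.1)] at hL
        simp only [RExp.val, NExp.val, r3, r4, r5, r6, hr, not_le] at hL
        rw [r3, r4, reach_succ hpk, max_eq_left hL.le]
        exact ⟨h0, hr⟩
  · rw [Program.exec_branch_false hC, Program.exec_nset]
    simp only [NExp.val]
    refine ⟨hF.nstore (by decide) _ _, ?_, ?_⟩
    · simp only [hstep, ← hgood]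
      exact ⟨fun h => absurd (by simp) h, fun h => absurd ((hcond h.1).2 h.2) hC⟩
    · intro h
      exact absurd (by simp) h

theorem ensures_pairTest {I : PBSInstance} {s : State} (hs : I.HoldsInput s) {p q : ℕ}
    (hp : s.nat 11 0 = p) (hq : s.nat 12 0 = q) (hpq : p < q)
    (hne : I.pointAt p ≠ I.pointAt q) (hn : q ≤ p + I.n) :
    Ensures pairTest s (2000 * I.n) fun s' => Frame [13, 14] [3, 4, 5, 6] s s' ∧
      (s'.nat 14 0 ≠ 0 ↔ IsShortcut I.pointAt (2 * I.δ) p q) := by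
  have hn1 := I.n_pos
  have hδ : 0 ≤ 2 * I.δ := mul_nonneg zero_le_two I.δ_nonneg
  set s₀ := (Program.seq (.rset 3 (.lit 0) (.lit 0)) (.seq (.rset 4 (.lit 0) (.lit 0))
    (.nset 14 (.lit 0) (.lit 1)))).exec s with h0
  have hs₀ : s₀ = ((s.rstore 3 0 0).rstore 4 0 0).nstore 14 0 1 := by
    simp [h0, Program.exec, NExp.val, RExp.val]
  have hF₀ : Frame [13, 14] [3, 4, 5, 6] s s₀ := by
    rw [hs₀]
    exact (((Frame.refl _ _ s).rstore (by decide) _ _).rstore (by decide) _ _).nstore (by decide) _ _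
  have hn11 : ∀ {s'}, Frame [13, 14] [3, 4, 5, 6] s s' → s'.nat 11 0 = p := fun hF => by
    rw [hF.1 11 (by decide), hp]
  have hn12 : ∀ {s'}, Frame [13, 14] [3, 4, 5, 6] s s' → s'.nat 12 0 = q := fun hF => by
    rw [hF.1 12 (by decide), hq]
  have hin : ∀ {s'}, Frame [13, 14] [3, 4, 5, 6] s s' → I.HoldsInput s' := fun hF =>
    hs.frame hF (by decide) (by decide)
  have hloop := Ensures.forLoop (x := 13) (lo := .add (nvar 11) (.lit 1)) (hi := nvar 12)
    (c := traverseStep) (s := s₀) (l := p + 1) (h := q) (B := 1000)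
    (Q := fun s' => Frame [13, 14] [3, 4, 5, 6] s s' ∧ TraverseInv I p q q s')
    (fun k s' => Frame [13, 14] [3, 4, 5, 6] s s' ∧ TraverseInv I p q k s')
    (by simp only [NExp.val, hn11 hF₀])
    ⟨hF₀, by
      constructor
      · refine ⟨fun _ j h1 h2 => absurd h1 (by omega), fun _ => by simp [hs₀]⟩
      · intro _
        simp [hs₀, reach_of_le]⟩
    (by
      rintro k s' v ⟨hF, h1, h2⟩
      refine ⟨hF.nstore (by decide) _ _, ⟨?_, ?_⟩⟩
      · simpa using h1
      · simpa using h2)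
    (by
      rintro k s' ⟨hF, -⟩
      simp only [NExp.val, hn12 hF])
    (by
      rintro k s' hk1 hk2 ⟨hF, hI⟩ hx
      refine (ensures_traverseStep (hin hF) (hn11 hF) (hn12 hF) hx hk1 hI).mono le_rfl ?_
      rintro s'' ⟨hF', hI'⟩
      refine ⟨⟨hF.trans (hF'.mono (by decide) (by decide)), hI'⟩, ?_⟩
      rw [hF'.1 13 (by decide), hx])
    (by
      intro s' h
      rwa [max_eq_right (by omega)] at h)
  refine Ensures.mono (Ensures.seq_exec ?_ (Ensures.seq (h0 ▸ hloop) (B₂ := 500) ?_)) ?_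
    fun s' h => h
  · simp [Program.LoopFree]
  · rintro s' ⟨hF, hgood, hreach⟩
    refine .of_exec (by simp [Program.LoopFree]) (by decide) ?_
    have e : (projExp (nvar 12)).val s' = projPos I.pointAt p q q := by
      rw [projExp_val (hin hF), hn11 hF, hn12 hF]
      simp only [NExp.val, hn12 hF]
    have hcond : s'.nat 14 0 ≠ 0 → ((leftLeRight (rvar 3) (rvar 4) (projExp (nvar 12))
        (.lit 0)).Holds s' ↔ reach I.pointAt (2 * I.δ) p q q ≤ projPos I.pointAt p q q) := by
      intro hok
      obtain ⟨h0, hr⟩ := hreach hok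
      rw [leftLeRight_holds (by simpa only [RExp.val, NExp.val] using h0) (by simp [RExp.val]), e]
      simp [RExp.val, NExp.val, hr]
    rw [isShortcut_iff hne hδ hpq, ← hgood]
    by_cases hC : (leftLeRight (rvar 3) (rvar 4) (projExp (nvar 12)) (.lit 0)).Holds s'
    · rw [Program.exec_branch_true hC, Program.exec_skip]
      exact ⟨hF, fun h => ⟨h, (hcond h).1 hC⟩, And.left⟩
    · rw [Program.exec_branch_false hC, Program.exec_nset]
      simp only [NExp.val]
      refine ⟨hF.nstore (by decide) _ _, fun h => absurd (by simp) h, fun h => ?_⟩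
      exact absurd ((hcond h.1).2 h.2) hC
  · have h1 : q - (p + 1) + 1 ≤ I.n := by omega
    simp only [Program.maxCost, NExp.cost, RExp.cost]
    nlinarith

end RealRAM

/-! ### The first failing partner of each position -/

namespace RealRAM

open PBSInstance

/-- Among the positions after `p` and before `e`, the first one that does not form a shortcut of
error `2 δ` with `p` is `v`; if there is none, `v` is `0`. -/
def IsThreshold (I : PBSInstance) (e p v : ℕ) : Prop :=
  (v = 0 ∧ ∀ q, p < q → q < e → IsShortcut I.pointAt (2 * I.δ) p q) ∨
  (p < v ∧ v < e ∧ ¬ IsShortcut I.pointAt (2 * I.δ) p v ∧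
    ∀ q, p < q → q < v → IsShortcut I.pointAt (2 * I.δ) p q)

/-- If no failing partner of the position in the variable `11` is stored yet, test the position in
the variable `12`. -/
def thresholdStep : Program :=
  .branch (.nle (.read 5 (nvar 11)) (.lit 0))
    (.seq pairTest (.branch (.nle (nvar 14) (.lit 0)) (.nset 5 (nvar 11) (nvar 12)) .skip)) .skip

/-- Computes the first failing partner of the position in the variable `11`. -/
def threshold : Program :=
  .seq (.nset 5 (nvar 11) (.lit 0))
    (forLoop 12 (.add (nvar 11) (.lit 1)) (.read 2 (.add (nvar 10) (.lit 1))) thresholdStep)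

/-- Computes the first failing partners of all positions. -/
def thresholds : Program :=
  forLoop 10 (.lit 0) (nvar 1)
    (forLoop 11 (.read 2 (nvar 10)) (.read 2 (.add (nvar 10) (.lit 1))) threshold)

variable {I : PBSInstance}

theorem lineStart_succ_le (i : Fin I.ℓ) : I.lineStart (i + 1) ≤ I.lineStart i + I.n := by
  rw [I.lineStart_succ]
  have := I.length_line_le i
  omega

theorem ensures_thresholdStep {s : State} (hs : I.HoldsInput s) (i : Fin I.ℓ) {p q : ℕ}
    (hp : s.nat 11 0 = p) (hq : s.nat 12 0 = q) (hip : I.lineStart i ≤ p) (hpq : p < q)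
    (hqi : q < I.lineStart (i + 1)) (hv : IsThreshold I q p (s.nat 5 p)) :
    Ensures thresholdStep s (2100 * I.n) fun s' => Frame [5, 13, 14] [3, 4, 5, 6] s s' ∧
      (∀ x, x ≠ p → s'.nat 5 x = s.nat 5 x) ∧ IsThreshold I (q + 1) p (s'.nat 5 p) := by
  have hn1 := I.n_pos
  have hle := lineStart_succ_le i
  refine Ensures.mono (B := (Test.nle (.read 5 (nvar 11)) (.lit 0)).cost + (2000 * I.n + 30))
    (Ensures.branch ?_ ?_) ?_ fun s' h => h
  · intro h0
    simp only [Test.Holds, NExp.val, hp, Nat.le_zero] at h0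
    have hall : ∀ x, p < x → x < q → IsShortcut I.pointAt (2 * I.δ) p x := by
      rcases hv with hv | hv
      · exact hv.2
      · omega
    refine (ensures_pairTest hs hp hq hpq (I.pointAt_ne i hip hpq hqi) (by omega)).seq ?_
    rintro s' ⟨hF, hok⟩
    have h5 : s'.nat 5 = s.nat 5 := hF.1 5 (by decide)
    have hF' : Frame [5, 13, 14] [3, 4, 5, 6] s s' := hF.mono (by decide) (by decide)
    refine .of_exec (by simp [Program.LoopFree]) (by decide) ?_
    by_cases hC : (Test.nle (nvar 14) (.lit 0)).Holds s'
    · rw [Program.exec_branch_true hC, Program.exec_nset]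
      simp only [Test.Holds, NExp.val, Nat.le_zero] at hC
      simp only [NExp.val, hF.1 11 (by decide), hF.1 12 (by decide), hp, hq]
      refine ⟨hF'.nstore (by decide) _ _, fun x hx => ?_, Or.inr ?_⟩
      · simp [hx, h5]
      · simp only [State.nstore_nat, true_and, if_true]
        refine ⟨hpq, by omega, ?_, hall⟩
        rw [← hok, not_not]
        exact hC
    · rw [Program.exec_branch_false hC, Program.exec_skip]
      simp only [Test.Holds, NExp.val, Nat.le_zero] at hC
      refine ⟨hF', fun x _ => by rw [h5], Or.inl ⟨by rw [h5, h0], fun x hx1 hx2 => ?_⟩⟩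
      rcases Nat.lt_succ_iff_lt_or_eq.1 hx2 with h | rfl
      · exact hall x hx1 h
      · exact hok.1 hC
  · intro h0
    simp only [Test.Holds, NExp.val, hp, Nat.le_zero] at h0
    refine .of_exec (c := .skip) trivial (by simp [Program.maxCost]) ?_
    rw [Program.exec_skip]
    refine ⟨Frame.refl _ _ _, fun _ _ => rfl, ?_⟩
    rcases hv with hv | hv
    · exact absurd hv.1 h0
    · exact Or.inr ⟨hv.1, by omega, hv.2.2⟩
  · simp only [Test.cost, NExp.cost]
    omega

theorem ensures_threshold {s : State} (hs : I.HoldsInput s) (i : Fin I.ℓ) {p : ℕ}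
    (hi : s.nat 10 0 = i) (hp : s.nat 11 0 = p) (hip : I.lineStart i ≤ p)
    (hpi : p < I.lineStart (i + 1)) :
    Ensures threshold s (3000 * I.n ^ 2) fun s' => Frame [5, 12, 13, 14] [3, 4, 5, 6] s s' ∧
      (∀ x, x ≠ p → s'.nat 5 x = s.nat 5 x) ∧
      IsThreshold I (I.lineStart (i + 1)) p (s'.nat 5 p) := by
  have hn1 := I.n_pos
  have hle := lineStart_succ_le i
  have hin : ∀ {s'}, Frame [5, 12, 13, 14] [3, 4, 5, 6] s s' → I.HoldsInput s' := fun hF =>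
    hs.frame hF (by decide) (by decide)
  have hn11 : ∀ {s'}, Frame [5, 12, 13, 14] [3, 4, 5, 6] s s' → s'.nat 11 0 = p := fun hF => by
    rw [hF.1 11 (by decide), hp]
  refine Ensures.mono (Ensures.seq_exec ?_ (Ensures.forLoop
    (l := p + 1) (h := I.lineStart (i + 1)) (B := 2100 * I.n)
    (fun k s' => Frame [5, 12, 13, 14] [3, 4, 5, 6] s s' ∧
      (∀ x, x ≠ p → s'.nat 5 x = s.nat 5 x) ∧ IsThreshold I k p (s'.nat 5 p))
    ?_ ?_ ?_ ?_ ?_ fun s' h => h)) ?_ ?_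
  · trivial
  · simp [Program.exec, NExp.val, hp]
  · rw [Program.exec_nset]
    simp only [NExp.val, hp]
    refine ⟨(Frame.refl _ _ _).nstore (by decide) _ _, fun x hx => by simp [hx], Or.inl ⟨?_, ?_⟩⟩
    · simp
    · exact fun q h1 h2 => absurd h1 (by omega)
  · rintro k s' v ⟨hF, h1, h2⟩
    refine ⟨hF.nstore (by decide) _ _, ?_, ?_⟩
    · simpa using h1
    · simpa using h2
  · rintro k s' ⟨hF, -⟩
    simp only [NExp.val, hF.1 10 (by decide), hi, (hin hF).lineStart_eq i.isLt]
  · rintro k s' hk1 hk2 ⟨hF, h1, h2⟩ hx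
    refine (ensures_thresholdStep (hin hF) i (hn11 hF) hx hip hk1 hk2 h2).mono le_rfl ?_
    rintro s'' ⟨hF', h1', h2'⟩
    refine ⟨⟨hF.trans (hF'.mono (by decide) (by decide)), fun x hx => ?_, h2'⟩, ?_⟩
    · rw [h1' x hx, h1 x hx]
    · rw [hF'.1 12 (by decide), hx]
  · simp only [Program.maxCost, NExp.cost]
    have h1 : I.lineStart (i + 1) - (p + 1) + 1 ≤ I.n := by omega
    nlinarith
  · rintro s' ⟨hF, h1, h2⟩
    rw [max_eq_right (by omega)] at h2
    exact ⟨hF, h1, h2⟩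

/-- The failing partners of all positions before `k` are known. -/
def ThresholdsUpTo (I : PBSInstance) (k : ℕ) (s : State) : Prop :=
  ∀ (i : Fin I.ℓ) (x : ℕ), I.lineStart i ≤ x → x < I.lineStart (i + 1) → x < k →
    IsThreshold I (I.lineStart (i + 1)) x (s.nat 5 x)

theorem lineStart_mono {a b : ℕ} (hab : a ≤ b) (hb : b ≤ I.ℓ) :
    I.lineStart a ≤ I.lineStart b := by
  induction b, hab using Nat.le_induction with
  | base => exact le_rfl
  | succ b hab ih =>
    have := I.lineStart_succ ⟨b, hb⟩
    have := ih (by omega)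
    dsimp only at *
    omega

/-- Every position belongs to only one polyline. -/
theorem line_unique {i j : Fin I.ℓ} {x : ℕ} (hi1 : I.lineStart i ≤ x)
    (hi2 : x < I.lineStart (i + 1)) (hj1 : I.lineStart j ≤ x) (hj2 : x < I.lineStart (j + 1)) :
    i = j := by
  rcases lt_trichotomy i j with h | h | h
  · have := lineStart_mono (I := I) (a := i + 1) (b := j) (by omega) (by omega)
    omega
  · exact h
  · have := lineStart_mono (I := I) (a := j + 1) (b := i) (by omega) (by omega)
    omega

theorem ensures_thresholds {s : State} (hs : I.HoldsInput s) :
    Ensures thresholds s (5000 * (I.ℓ * I.n ^ 3)) fun s' =>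
      Frame [5, 10, 11, 12, 13, 14] [3, 4, 5, 6] s s' ∧
      ThresholdsUpTo I (I.lineStart I.ℓ) s' := by
  have hn1 := I.n_pos
  have hℓ1 := I.ℓ_pos
  have hin : ∀ {s'}, Frame [5, 10, 11, 12, 13, 14] [3, 4, 5, 6] s s' → I.HoldsInput s' :=
    fun hF => hs.frame hF (by decide) (by decide)
  refine Ensures.mono (Ensures.forLoop (l := 0) (h := I.ℓ) (B := 4000 * I.n ^ 3)
    (fun k s' => Frame [5, 10, 11, 12, 13, 14] [3, 4, 5, 6] s s' ∧
      ThresholdsUpTo I (I.lineStart k) s') rfl ?_ ?_ ?_ ?_ fun s' h => h) ?_ ?_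
  · exact ⟨Frame.refl _ _ _, fun i x _ _ hx => absurd hx (by simp [I.lineStart_zero])⟩
  · rintro k s' v ⟨hF, h⟩
    refine ⟨hF.nstore (by decide) _ _, fun i x h1 h2 h3 => ?_⟩
    simpa using h i x h1 h2 h3
  · rintro k s' ⟨hF, -⟩
    simp only [NExp.val, (hin hF).ℓ_eq]
  · rintro k s' - hk ⟨hF, hT⟩ hx
    have hle := lineStart_succ_le (I := I) ⟨k, hk⟩
    have hle' := lineStart_mono (I := I) (Nat.le_succ k) hk
    dsimp only at hle
    have hin' : ∀ {s''}, Frame [5, 11, 12, 13, 14] [3, 4, 5, 6] s' s'' → I.HoldsInput s'' :=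
      fun hF' => (hin hF).frame hF' (by decide) (by decide)
    have hn10 : ∀ {s''}, Frame [5, 11, 12, 13, 14] [3, 4, 5, 6] s' s'' → s''.nat 10 0 = k :=
      fun hF' => by rw [hF'.1 10 (by decide), hx]
    refine Ensures.mono (Ensures.forLoop (l := I.lineStart k) (h := I.lineStart (k + 1))
      (B := 3000 * I.n ^ 2)
      (fun m s'' => Frame [5, 11, 12, 13, 14] [3, 4, 5, 6] s' s'' ∧ ThresholdsUpTo I m s'')
      ?_ ?_ ?_ ?_ ?_ fun s' h => h) ?_ ?_
    · simp only [NExp.val, hx, (hin hF).lineStart_eq hk.le]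
    · exact ⟨Frame.refl _ _ _, hT⟩
    · rintro m s'' v ⟨hF', h⟩
      refine ⟨hF'.nstore (by decide) _ _, fun i x h1 h2 h3 => ?_⟩
      simpa using h i x h1 h2 h3
    · rintro m s'' ⟨hF', -⟩
      simp only [NExp.val, hn10 hF', (hin' hF').lineStart_eq hk]
    · rintro m s'' hm1 hm2 ⟨hF', hT'⟩ hx'
      refine (ensures_threshold (hin' hF') ⟨k, hk⟩ (hn10 hF') hx' hm1 hm2).mono le_rfl ?_
      rintro t ⟨hFt, h1, h2⟩
      refine ⟨⟨hF'.trans (hFt.mono (by decide) (by decide)), fun i x hx1 hx2 hx3 => ?_⟩, ?_⟩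
      · rcases Nat.lt_succ_iff_lt_or_eq.1 hx3 with h | rfl
        · rw [h1 x h.ne]
          exact hT' i x hx1 hx2 h
        · obtain rfl := line_unique hx1 hx2 (j := ⟨k, hk⟩) hm1 hm2
          exact h2
      · rw [hFt.1 11 (by decide), hx']
    · simp only [NExp.cost]
      have h1 : I.lineStart (k + 1) - I.lineStart k ≤ I.n := by omega
      have h2 : I.n ≤ I.n ^ 3 := Nat.le_self_pow (by omega) _
      have h3 := Nat.mul_le_mul h1 (le_refl (3000 * I.n ^ 2 + 20))
      linarith
    · rintro t ⟨hF', hT'⟩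
      rw [max_eq_right hle'] at hT'
      exact ⟨⟨hF.trans (hF'.mono (by decide) (by decide)), hT'⟩, hn10 hF'⟩
  · simp only [NExp.cost]
    have h3 : I.ℓ ≤ I.ℓ * I.n ^ 3 := Nat.le_mul_of_pos_right _ (Nat.pow_pos hn1)
    rw [Nat.sub_zero]
    linarith
  · rintro s' ⟨hF, h⟩
    rw [max_eq_right (by omega)] at h
    exact ⟨hF, h⟩

end RealRAM

/-! ### Greedy hitting sets of families of intervals -/

namespace GreedyHitting

section

variable (D : ℕ → ℕ) (T : ℕ) (thr : ℕ → ℕ)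

/-- The number of occurrences of the label `v` in the intervals `(p, thr p)`, `p < T`, where
position `x` carries the label `D x`. -/
def occ (v : ℕ) : ℕ :=
  ∑ p ∈ Finset.range T, ∑ x ∈ Finset.Ico (p + 1) (thr p), if D x = v then 1 else 0

open Classical in
/-- Discard the intervals in which `v` occurs; a discarded interval has the right end `0`. -/
noncomputable def discard (v p : ℕ) : ℕ :=
  if ∃ x ∈ Finset.Ico (p + 1) (thr p), D x = v then 0 else thr p

/-- The number of intervals that are not discarded. -/
def active : ℕ := ∑ p ∈ Finset.range T, if thr p = 0 then 0 else 1

end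

variable {D : ℕ → ℕ} {T : ℕ} {thr : ℕ → ℕ}

/-- As a label occurs at most once in an interval, its number of occurrences is the number of
intervals that it hits. -/
theorem active_discard_add_occ
    (hinj : ∀ p < T, ∀ x ∈ Finset.Ico (p + 1) (thr p), ∀ y ∈ Finset.Ico (p + 1) (thr p),
      D x = D y → x = y) (v : ℕ) :
    active T (discard D thr v) + occ D T thr v = active T thr := by
  unfold active occ
  rw [← Finset.sum_add_distrib]
  refine Finset.sum_congr rfl fun p hp => ?_
  unfold discard
  by_cases hv : ∃ x ∈ Finset.Ico (p + 1) (thr p), D x = v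
  · obtain ⟨x, hx, hxv⟩ := id hv
    have h0 : thr p ≠ 0 := by
      have := Finset.mem_Ico.1 hx
      omega
    rw [if_pos hv, if_pos rfl, if_neg h0, Nat.zero_add, Finset.sum_eq_single_of_mem x hx, if_pos hxv]
    intro y hy hyx
    rw [if_neg]
    intro hyv
    exact hyx (hinj p (Finset.mem_range.1 hp) y hy x hx (hyv.trans hxv.symm))
  · rw [if_neg hv, Finset.sum_eq_zero, Nat.add_zero]
    intro x hx
    rw [if_neg fun h => hv ⟨x, hx, h⟩]

/-- Some element of a hitting set `H` hits at least the fraction `1 / |H|` of the intervals. -/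
theorem active_le_mul_occ {H : Finset ℕ} {b : ℕ} (hb : ∀ v ∈ H, occ D T thr v ≤ occ D T thr b)
    (hH : ∀ p < T, thr p ≠ 0 → ∃ x ∈ Finset.Ico (p + 1) (thr p), D x ∈ H) :
    active T thr ≤ H.card * occ D T thr b := by
  calc active T thr ≤ ∑ v ∈ H, occ D T thr v := by
        unfold active occ
        rw [Finset.sum_comm]
        refine Finset.sum_le_sum fun p hp => ?_
        split_ifs with h0
        · exact Nat.zero_le _
        · obtain ⟨x, hx, hxH⟩ := hH p (Finset.mem_range.1 hp) h0
          calc 1 = if D x = D x then 1 else 0 := by simp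
            _ ≤ ∑ y ∈ Finset.Ico (p + 1) (thr p), if D y = D x then 1 else 0 :=
              Finset.single_le_sum (f := fun y => if D y = D x then 1 else 0)
                (fun _ _ => Nat.zero_le _) hx
            _ ≤ _ := Finset.single_le_sum
              (f := fun v => ∑ y ∈ Finset.Ico (p + 1) (thr p), if D y = v then 1 else 0)
              (fun _ _ => Nat.zero_le _) hxH
    _ ≤ H.card * occ D T thr b := by
        rw [← smul_eq_mul]
        exact Finset.sum_le_card_nsmul _ _ _ hb

/-- The greedy algorithm for the intervals `(p, thr₀ p)` has done `r` rounds, has picked the set `G`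
of labels, and `thr` describes the intervals that are not hit by `G`. The number `k` is the size of
some hitting set; each pick decreases the number of intervals by the factor `1 - 1 / k`. -/
structure Inv (D : ℕ → ℕ) (T : ℕ) (thr₀ : ℕ → ℕ) (n k r : ℕ) (thr : ℕ → ℕ) (G : Finset ℕ) :
    Prop where
  subset : G ⊆ Finset.range n
  unhit : ∀ p < T, thr p ≠ 0 → thr p = thr₀ p ∧ ∀ x ∈ Finset.Ico (p + 1) (thr₀ p), D x ∉ G
  hit : ∀ p < T, thr p = 0 → thr₀ p ≠ 0 → ∃ x ∈ Finset.Ico (p + 1) (thr₀ p), D x ∈ G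
  card_eq : (∃ p < T, thr p ≠ 0) → G.card = r
  active_mul_le : active T thr * k ^ G.card ≤ T * (k - 1) ^ G.card
  pow_le : G = ∅ ∨ k ^ (G.card - 1) ≤ T * (k - 1) ^ (G.card - 1)

variable {thr₀ : ℕ → ℕ} {n r : ℕ} {G H : Finset ℕ}

theorem active_le : active T thr ≤ T := by
  calc active T thr ≤ ∑ _p ∈ Finset.range T, 1 := by
        unfold active
        gcongr
        split_ifs <;> omega
    _ = T := by simp

theorem active_pos_iff : 0 < active T thr ↔ ∃ p < T, thr p ≠ 0 := by
  unfold active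
  rw [Finset.sum_pos_iff]
  refine exists_congr fun p => ?_
  rw [Finset.mem_range]
  split_ifs with h <;> simp [h]

theorem Inv.init (k : ℕ) : Inv D T thr₀ n k 0 thr₀ ∅ where
  subset := by simp
  unhit _ _ _ := ⟨rfl, by simp⟩
  hit _ _ h h' := absurd h h'
  card_eq _ := rfl
  active_mul_le := by simpa using active_le
  pow_le := Or.inl rfl

/-- The invariant depends only on the values of `thr` at the intervals of the family. -/
theorem Inv.congr {k : ℕ} {thr' : ℕ → ℕ} (h : Inv D T thr₀ n k r thr G)
    (heq : ∀ p < T, thr' p = thr p) : Inv D T thr₀ n k r thr' G where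
  subset := h.subset
  unhit p hp := by rw [heq p hp]; exact h.unhit p hp
  hit p hp := by rw [heq p hp]; exact h.hit p hp
  card_eq := fun ⟨p, hp, hp'⟩ => h.card_eq ⟨p, hp, by rwa [← heq p hp]⟩
  active_mul_le := by
    have : active T thr' = active T thr :=
      Finset.sum_congr rfl fun p hp => by rw [heq p (Finset.mem_range.1 hp)]
    rw [this]
    exact h.active_mul_le
  pow_le := h.pow_le

theorem Inv.exists_mem {k : ℕ} (h : Inv D T thr₀ n k r thr G)
    (hH : ∀ p < T, thr₀ p ≠ 0 → ∃ x ∈ Finset.Ico (p + 1) (thr₀ p), D x ∈ H) :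
    ∀ p < T, thr p ≠ 0 → ∃ x ∈ Finset.Ico (p + 1) (thr p), D x ∈ H := by
  intro p hp h0
  have := (h.unhit p hp h0).1
  rw [this] at h0 ⊢
  exact hH p hp h0

/-- If the most frequent label does not occur at all, everything is hit. -/
theorem Inv.skip {k b : ℕ} (h : Inv D T thr₀ n k r thr G) (hHn : H ⊆ Finset.range n)
    (hH : ∀ p < T, thr₀ p ≠ 0 → ∃ x ∈ Finset.Ico (p + 1) (thr₀ p), D x ∈ H)
    (hb : ∀ v < n, occ D T thr v ≤ occ D T thr b) (h0 : occ D T thr b = 0) :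
    Inv D T thr₀ n k (r + 1) thr G where
  subset := h.subset
  unhit := h.unhit
  hit := h.hit
  card_eq hp := by
    have h1 := active_pos_iff.2 hp
    have h2 := active_le_mul_occ (fun v hv => hb v (Finset.mem_range.1 (hHn hv)))
      (h.exists_mem hH)
    rw [h0] at h2
    omega
  active_mul_le := h.active_mul_le
  pow_le := h.pow_le

theorem exists_of_occ_ne_zero {v : ℕ} (h : occ D T thr v ≠ 0) :
    ∃ p < T, ∃ x ∈ Finset.Ico (p + 1) (thr p), D x = v := by
  obtain ⟨p, hp, h⟩ := Finset.exists_ne_zero_of_sum_ne_zero h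
  obtain ⟨x, hx, h⟩ := Finset.exists_ne_zero_of_sum_ne_zero h
  exact ⟨p, Finset.mem_range.1 hp, x, hx, by by_contra hne; exact h (if_neg hne)⟩

theorem Inv.pick {b : ℕ} (h : Inv D T thr₀ n H.card r thr G) (hHn : H ⊆ Finset.range n)
    (hH : ∀ p < T, thr₀ p ≠ 0 → ∃ x ∈ Finset.Ico (p + 1) (thr₀ p), D x ∈ H)
    (hinj : ∀ p < T, ∀ x ∈ Finset.Ico (p + 1) (thr₀ p), ∀ y ∈ Finset.Ico (p + 1) (thr₀ p),
      D x = D y → x = y)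
    (hbn : b < n) (hb : ∀ v < n, occ D T thr v ≤ occ D T thr b) (h0 : occ D T thr b ≠ 0) :
    Inv D T thr₀ n H.card (r + 1) (discard D thr b) (insert b G) := by
  obtain ⟨p₀, hp₀, x₀, hx₀, hxb⟩ := exists_of_occ_ne_zero h0
  have hp0 : thr p₀ ≠ 0 := by
    have := Finset.mem_Ico.1 hx₀
    omega
  have hbG : b ∉ G := by
    obtain ⟨h1, h2⟩ := h.unhit p₀ hp₀ hp0
    rw [h1] at hx₀
    exact hxb ▸ h2 x₀ hx₀
  have hcard : (insert b G).card = G.card + 1 := Finset.card_insert_of_notMem hbG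
  have hact := active_le_mul_occ (fun v hv => hb v (Finset.mem_range.1 (hHn hv))) (h.exists_mem hH)
  have hdis := active_discard_add_occ (D := D) (T := T) (thr := thr) (by
    intro p hp x hx y hy hxy
    have h1 : thr p ≠ 0 := by
      have := Finset.mem_Ico.1 hx
      omega
    rw [(h.unhit p hp h1).1] at hx hy
    exact hinj p hp x hx y hy hxy) b
  have hpos : 0 < active T thr := active_pos_iff.2 ⟨p₀, hp₀, hp0⟩
  refine ⟨?_, ?_, ?_, ?_, ?_, Or.inr ?_⟩
  · exact Finset.insert_subset (Finset.mem_range.2 hbn) h.subset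
  · intro p hp hne
    unfold discard at hne ⊢
    split_ifs at hne ⊢ with hex
    · exact absurd rfl hne
    · obtain ⟨h1, h2⟩ := h.unhit p hp hne
      refine ⟨h1, fun x hx hxG => ?_⟩
      rcases Finset.mem_insert.1 hxG with hxb | hxG
      · exact hex ⟨x, h1 ▸ hx, hxb⟩
      · exact h2 x hx hxG
  · intro p hp hz h0
    unfold discard at hz
    split_ifs at hz with hex
    · obtain ⟨x, hx, hxb⟩ := hex
      have h1 : thr p ≠ 0 := by
        have := Finset.mem_Ico.1 hx
        omega
      exact ⟨x, (h.unhit p hp h1).1 ▸ hx, hxb ▸ Finset.mem_insert_self _ _⟩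
    · obtain ⟨x, hx, hxG⟩ := h.hit p hp hz h0
      exact ⟨x, hx, Finset.mem_insert_of_mem hxG⟩
  · intro _
    rw [hcard, h.card_eq ⟨p₀, hp₀, hp0⟩]
  · rw [hcard]
    set k := H.card with hk
    have hk1 : 1 ≤ k := by
      by_contra hk0
      have : k = 0 := by omega
      rw [this] at hact
      omega
    obtain ⟨m, hm⟩ : ∃ m, k = m + 1 := ⟨k - 1, by omega⟩
    have hpot := h.active_mul_le
    rw [hm, Nat.add_sub_cancel] at hpot ⊢
    rw [hm] at hact
    have h1 : active T (discard D thr b) * (m + 1) ≤ active T thr * m := by nlinarith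
    calc active T (discard D thr b) * (m + 1) ^ (G.card + 1)
        = (active T (discard D thr b) * (m + 1)) * (m + 1) ^ G.card := by ring
      _ ≤ (active T thr * m) * (m + 1) ^ G.card := by gcongr
      _ = (active T thr * (m + 1) ^ G.card) * m := by ring
      _ ≤ (T * m ^ G.card) * m := by gcongr
      _ = T * m ^ (G.card + 1) := by ring
  · rw [hcard, Nat.add_sub_cancel]
    exact (Nat.le_mul_of_pos_left _ hpos).trans h.active_mul_le

/-- After as many rounds as there are labels, all intervals are hit. -/
theorem Inv.hit_all {k : ℕ} (h : Inv D T thr₀ n k n thr G) (hHn : H ⊆ Finset.range n)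
    (hH : ∀ p < T, thr₀ p ≠ 0 → ∃ x ∈ Finset.Ico (p + 1) (thr₀ p), D x ∈ H) :
    ∀ p < T, thr₀ p ≠ 0 → ∃ x ∈ Finset.Ico (p + 1) (thr₀ p), D x ∈ G := by
  intro p hp h0
  by_cases hz : thr p = 0
  · exact h.hit p hp hz h0
  · have hG : G = Finset.range n :=
      Finset.eq_of_subset_of_card_le h.subset (by simp [h.card_eq ⟨p, hp, hz⟩])
    obtain ⟨x, hx, hxH⟩ := hH p hp h0
    exact ⟨x, hx, hG ▸ hHn hxH⟩

/-- Before the last pick some interval was not hit, so `1 ≤ T (1 - 1 / k) ^ (|G| - 1)`. -/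
theorem Inv.card_le {k : ℕ} (h : Inv D T thr₀ n k r thr G) (hk : 0 < k) (hT : 0 < T) :
    (G.card : ℝ) ≤ k * Real.log T + 1 := by
  have hk' : (0 : ℝ) < k := by exact_mod_cast hk
  have hT' : (1 : ℝ) ≤ T := by exact_mod_cast hT
  have hlog := Real.log_nonneg hT'
  rcases h.pow_le with rfl | hp
  · simp only [Finset.card_empty, Nat.cast_zero]
    positivity
  obtain ⟨c, hc⟩ : ∃ c, c = G.card - 1 := ⟨_, rfl⟩
  have hcG : (G.card : ℝ) ≤ c + 1 := by exact_mod_cast (by omega : G.card ≤ c + 1)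
  rw [← hc] at hp
  have hp' : (k : ℝ) ^ c ≤ T * ((k : ℝ) - 1) ^ c := by
    have : ((k ^ c : ℕ) : ℝ) ≤ ((T * (k - 1) ^ c : ℕ) : ℝ) := by exact_mod_cast hp
    rwa [Nat.cast_mul, Nat.cast_pow, Nat.cast_pow, Nat.cast_pred hk] at this
  have hk1 : (0 : ℝ) ≤ 1 - 1 / k := by
    rw [sub_nonneg, div_le_one hk']
    exact_mod_cast hk
  have h1 : 1 ≤ (T : ℝ) * Real.exp (-(c / k)) := by
    have h2 : (1 - 1 / (k : ℝ)) ^ c ≤ Real.exp (-(c / k)) := by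
      calc (1 - 1 / (k : ℝ)) ^ c ≤ Real.exp (-(1 / k)) ^ c := by
            gcongr
            have := Real.add_one_le_exp (-(1 / (k : ℝ)))
            linarith
        _ = Real.exp (-(c / k)) := by
            rw [← Real.exp_nat_mul]
            congr 1
            ring
    have h3 : (k : ℝ) ^ c ≤ (k : ℝ) ^ c * (T * (1 - 1 / (k : ℝ)) ^ c) := by
      calc (k : ℝ) ^ c ≤ T * ((k : ℝ) - 1) ^ c := hp'
        _ = T * ((k : ℝ) * (1 - 1 / k)) ^ c := by
            congr 2
            field_simp
        _ = _ := by rw [mul_pow]; ring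
    have h4 : 1 ≤ (T : ℝ) * (1 - 1 / (k : ℝ)) ^ c :=
      le_of_mul_le_mul_left (by simpa using h3) (pow_pos hk' c)
    exact h4.trans (by gcongr)
  have h5 : (c : ℝ) / k ≤ Real.log T := by
    rw [Real.le_log_iff_exp_le (by linarith)]
    rw [Real.exp_neg, ← div_eq_mul_inv, one_le_div (Real.exp_pos _)] at h1
    exact h1
  rw [div_le_iff₀ hk'] at h5
  linarith

end GreedyHitting

/-! ### The program for the greedy hitting set -/

namespace RealRAM

open PBSInstance GreedyHitting

/-- The total length of the polylines. -/
def totalLength : NExp := .read 2 (nvar 1)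

/-- Counts in array `6` how often each bend occurs in the intervals that are given by array `5`. -/
def countOccurrences : Program :=
  .seq (forLoop 16 (.lit 0) (nvar 0) (.nset 6 (nvar 16) (.lit 0)))
    (forLoop 11 (.lit 0) totalLength
      (forLoop 13 (.add (nvar 11) (.lit 1)) (.read 5 (nvar 11))
        (.nset 6 (.read 3 (nvar 13)) (.add (.read 6 (.read 3 (nvar 13))) (.lit 1)))))

/-- Stores in the variable `7` a bend with the largest entry of array `6`. -/
def selectBest : Program :=
  .seq (.nset 7 (.lit 0) (.lit 0))
    (forLoop 16 (.lit 0) (nvar 0)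
      (.branch (.nle (.read 6 (nvar 7)) (.read 6 (nvar 16))) (.nset 7 (.lit 0) (nvar 16)) .skip))

/-- Discards the interval of the position in the variable `11` if the bend in the variable `7`
occurs in it. -/
def discardStep : Program :=
  .seq (.nset 8 (.lit 0) (.read 5 (nvar 11)))
    (forLoop 13 (.add (nvar 11) (.lit 1)) (nvar 8)
      (.branch (.conj (.nle (.read 3 (nvar 13)) (nvar 7)) (.nle (nvar 7) (.read 3 (nvar 13))))
        (.nset 5 (nvar 11) (.lit 0)) .skip))

/-- If the bend in the variable `7` occurs at all, retains it and discards the intervals that it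
hits. -/
def retainBest : Program :=
  .branch (.nle (.read 6 (nvar 7)) (.lit 0)) .skip
    (.seq (.nset 4 (nvar 7) (.lit 1)) (forLoop 11 (.lit 0) totalLength discardStep))

/-- The greedy algorithm for hitting all intervals that are given by array `5`. -/
def greedyHitting : Program :=
  forLoop 15 (.lit 0) (nvar 0) (.seq countOccurrences (.seq selectBest retainBest))

variable {I : PBSInstance}

theorem lineStart_total_le (I : PBSInstance) : I.lineStart I.ℓ ≤ I.ℓ * I.n :=
  I.lineStart_le I.ℓ le_rfl

theorem totalLength_val {s : State} (hs : I.HoldsInput s) :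
    totalLength.val s = I.lineStart I.ℓ := by
  simp only [totalLength, NExp.val, hs.ℓ_eq, hs.lineStart_eq le_rfl]

theorem ensures_countOccurrences {s : State} (hs : I.HoldsInput s)
    (hthr : ∀ p < I.lineStart I.ℓ, s.nat 5 p ≤ p + I.n) :
    Ensures countOccurrences s (200 * (I.ℓ * I.n ^ 2)) fun s' => Frame [6, 11, 13, 16] [] s s' ∧
      ∀ v < I.n, s'.nat 6 v = occ I.bendAt (I.lineStart I.ℓ) (s.nat 5) v := by
  have hn1 := I.n_pos
  have hℓ1 := I.ℓ_pos
  set T := I.lineStart I.ℓ with hT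
  have hTle : T ≤ I.ℓ * I.n := lineStart_total_le I
  have hin : ∀ {s'}, Frame [6, 11, 13, 16] [] s s' → I.HoldsInput s' :=
    fun hF => hs.frame hF (by decide) (by decide)
  have hclear := Ensures.forLoop (x := 16) (lo := .lit 0) (hi := nvar 0)
    (c := .nset 6 (nvar 16) (.lit 0)) (s := s) (l := 0) (h := I.n) (B := 10)
    (Q := fun s' => Frame [6, 11, 13, 16] [] s s' ∧ ∀ v < I.n, s'.nat 6 v = 0)
    (fun k s' => Frame [6, 11, 13, 16] [] s s' ∧ ∀ v < k, s'.nat 6 v = 0) rfl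
    ⟨Frame.refl _ _ _, fun v hv => absurd hv (by omega)⟩
    (by
      rintro k s' v ⟨hF, h⟩
      exact ⟨hF.nstore (by decide) _ _, by simpa using h⟩)
    (by
      rintro k s' ⟨hF, -⟩
      simp only [NExp.val, (hin hF).n_eq])
    (by
      rintro k s' - hk ⟨hF, h⟩ hx
      refine .of_exec (c := .nset _ _ _) trivial (by decide) ?_
      rw [Program.exec_nset]
      simp only [NExp.val, hx]
      refine ⟨⟨hF.nstore (by decide) _ _, fun v hv => ?_⟩, by simpa using hx⟩
      rcases Nat.lt_succ_iff_lt_or_eq.1 hv with hv | rfl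
      · simp [hv.ne, h v hv]
      · simp)
    (by
      intro s' h
      rwa [max_eq_right (Nat.zero_le _)] at h)
  refine Ensures.mono (Ensures.seq hclear (B₂ := 15 + T * (30 * I.n + 40)) ?_) ?_ fun s' h => h
  · rintro s₀ ⟨hF₀, hz⟩
    refine Ensures.mono (Ensures.forLoop (l := 0) (h := T) (B := 20 + 27 * I.n)
      (fun k s' => Frame [6, 11, 13, 16] [] s s' ∧
        ∀ v < I.n, s'.nat 6 v = occ I.bendAt k (s.nat 5) v) rfl ?_ ?_ ?_ ?_ fun s' h => h) ?_ ?_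
    · exact ⟨hF₀, fun v hv => by simp [hz v hv, occ]⟩
    · rintro k s' v ⟨hF, h⟩
      exact ⟨hF.nstore (by decide) _ _, by simpa using h⟩
    · rintro k s' ⟨hF, -⟩
      exact totalLength_val (hin hF)
    · rintro k s' - hk ⟨hF, h⟩ hx
      have h11 : ∀ {s''}, Frame [6, 13] [] s' s'' → s''.nat 11 0 = k := fun hF' => by
        rw [hF'.1 11 (by decide), hx]
      have h5 : ∀ {s''}, Frame [6, 13] [] s' s'' → s''.nat 5 = s.nat 5 := fun hF' => by
        rw [hF'.1 5 (by decide), hF.1 5 (by decide)]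
      refine Ensures.mono (Ensures.forLoop (l := k + 1) (h := s.nat 5 k) (B := 12)
        (fun y s'' => Frame [6, 13] [] s' s'' ∧ ∀ v < I.n, s''.nat 6 v =
          occ I.bendAt k (s.nat 5) v + ∑ x ∈ Finset.Ico (k + 1) y, if I.bendAt x = v then 1 else 0)
        ?_ ?_ ?_ ?_ ?_ fun s' h => h) ?_ ?_
      · simp only [NExp.val, hx]
      · exact ⟨Frame.refl _ _ _, fun v hv => by simp [h v hv]⟩
      · rintro y s'' v ⟨hF', h'⟩
        exact ⟨hF'.nstore (by decide) _ _, by simpa using h'⟩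
      · rintro y s'' ⟨hF', -⟩
        simp only [NExp.val, h11 hF', h5 hF']
      · rintro y s'' hy1 hy2 ⟨hF', h'⟩ hx'
        refine .of_exec (c := .nset _ _ _) trivial (by decide) ?_
        rw [Program.exec_nset]
        have hin' : I.HoldsInput s'' := (hin hF).frame hF' (by decide) (by decide)
        simp only [NExp.val, hx', hin'.bendAt_eq]
        refine ⟨⟨hF'.nstore (by decide) _ _, fun v hv => ?_⟩, by simpa using hx'⟩
        rw [Finset.sum_Ico_succ_top hy1, ← Nat.add_assoc, ← h' v hv]
        by_cases hv' : v = I.bendAt y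
        · subst hv'; simp
        · simp [hv', Ne.symm hv']
      · have := hthr k hk
        have h1 : s.nat 5 k - (k + 1) ≤ I.n := by omega
        have h2 := Nat.mul_le_mul h1 (le_refl 26)
        simp only [NExp.cost]
        linarith
      · rintro s'' ⟨hF', h'⟩
        refine ⟨⟨hF.trans (hF'.mono (by decide) (by decide)), fun v hv => ?_⟩, h11 hF'⟩
        rw [h' v hv, occ, occ, Finset.sum_range_succ]
        rcases le_total (k + 1) (s.nat 5 k) with hle | hle
        · rw [max_eq_right hle]
        · rw [max_eq_left hle, Finset.Ico_self, Finset.Ico_eq_empty (by omega)]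
    · simp only [NExp.cost, totalLength]
      rw [Nat.sub_zero]
      nlinarith
    · rintro s' ⟨hF, h⟩
      rw [max_eq_right (Nat.zero_le _)] at h
      exact ⟨hF, h⟩
  · have h1 : T * (30 * I.n + 40) ≤ I.ℓ * I.n * (70 * I.n) := Nat.mul_le_mul hTle (by omega)
    have h2 : I.n ≤ I.n ^ 2 := Nat.le_self_pow (by omega) _
    have h3 : I.n ^ 2 ≤ I.ℓ * I.n ^ 2 := Nat.le_mul_of_pos_left _ hℓ1
    simp only [NExp.cost]
    rw [Nat.sub_zero]
    nlinarith

theorem ensures_selectBest {s : State} (hs : I.HoldsInput s) :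
    Ensures selectBest s (100 * I.n) fun s' => Frame [7, 16] [] s s' ∧ s'.nat 7 0 < I.n ∧
      ∀ v < I.n, s'.nat 6 v ≤ s'.nat 6 (s'.nat 7 0) := by
  have hn1 := I.n_pos
  refine Ensures.mono (Ensures.seq_exec ?_ (Ensures.forLoop (l := 0) (h := I.n) (B := 20)
    (fun k s' => Frame [7, 16] [] s s' ∧ s'.nat 7 0 < I.n ∧
      ∀ v < k, s'.nat 6 v ≤ s'.nat 6 (s'.nat 7 0)) rfl ?_ ?_ ?_ ?_ fun s' h => h)) ?_ ?_
  · trivial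
  · rw [Program.exec_nset]
    simp only [NExp.val]
    exact ⟨(Frame.refl _ _ _).nstore (by decide) _ _, by simpa using hn1,
      fun v hv => absurd hv (by omega)⟩
  · rintro k s' v ⟨hF, h1, h2⟩
    exact ⟨hF.nstore (by decide) _ _, by simpa using h1, by simpa using h2⟩
  · rintro k s' ⟨hF, -⟩
    have hin' : I.HoldsInput s' := hs.frame hF (by decide) (by decide)
    simp only [NExp.val, hin'.n_eq]
  · rintro k s' - hk ⟨hF, h1, h2⟩ hx
    refine .of_exec (by simp [Program.LoopFree]) (by decide) ?_
    by_cases hC : (Test.nle (.read 6 (nvar 7)) (.read 6 (nvar 16))).Holds s'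
    · rw [Program.exec_branch_true hC, Program.exec_nset]
      simp only [Test.Holds, NExp.val, hx] at hC
      simp only [NExp.val, hx]
      refine ⟨⟨hF.nstore (by decide) _ _, by simpa using hk, fun v hv => ?_⟩, by simpa using hx⟩
      simp only [State.nstore_nat]
      norm_num
      rcases Nat.lt_succ_iff_lt_or_eq.1 hv with hv | rfl
      · exact (h2 v hv).trans hC
      · exact le_rfl
    · rw [Program.exec_branch_false hC, Program.exec_skip]
      simp only [Test.Holds, NExp.val, hx, not_le] at hC
      refine ⟨⟨hF, h1, fun v hv => ?_⟩, hx⟩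
      rcases Nat.lt_succ_iff_lt_or_eq.1 hv with hv | rfl
      · exact h2 v hv
      · exact hC.le
  · simp only [Program.maxCost, NExp.cost]
    rw [Nat.sub_zero]
    omega
  · rintro s' ⟨hF, h⟩
    rw [max_eq_right (Nat.zero_le _)] at h
    exact ⟨hF, h⟩

theorem ensures_discardStep {s : State} (hs : I.HoldsInput s) {p : ℕ} (hp : s.nat 11 0 = p)
    (hthr : s.nat 5 p ≤ p + I.n) :
    Ensures discardStep s (100 * I.n) fun s' => Frame [5, 8, 13] [] s s' ∧
      (∀ x, x ≠ p → s'.nat 5 x = s.nat 5 x) ∧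
      s'.nat 5 p = discard I.bendAt (s.nat 5) (s.nat 7 0) p := by
  classical
  have hn1 := I.n_pos
  have h11 : ∀ {s'}, Frame [5, 8, 13] [] s s' → s'.nat 11 0 = p := fun hF => by
    rw [hF.1 11 (by decide), hp]
  have h7 : ∀ {s'}, Frame [5, 8, 13] [] s s' → s'.nat 7 0 = s.nat 7 0 := fun hF => by
    rw [hF.1 7 (by decide)]
  refine Ensures.mono (Ensures.seq_exec ?_ (Ensures.forLoop (l := p + 1) (h := s.nat 5 p) (B := 30)
    (fun y s' => Frame [5, 8, 13] [] s s' ∧ s'.nat 8 0 = s.nat 5 p ∧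
      (∀ x, x ≠ p → s'.nat 5 x = s.nat 5 x) ∧
      s'.nat 5 p = if ∃ x ∈ Finset.Ico (p + 1) y, I.bendAt x = s.nat 7 0 then 0 else s.nat 5 p)
    ?_ ?_ ?_ ?_ ?_ fun s' h => h)) ?_ ?_
  · trivial
  · simp [Program.exec_nset, NExp.val, hp]
  · rw [Program.exec_nset]
    simp only [NExp.val, hp]
    exact ⟨(Frame.refl _ _ _).nstore (by decide) _ _, by simp, by simp, by simp⟩
  · rintro k s' v ⟨hF, h1, h2, h3⟩
    exact ⟨hF.nstore (by decide) _ _, by simpa using h1, by simpa using h2, by simpa using h3⟩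
  · rintro k s' ⟨hF, h1, -⟩
    simp only [NExp.val, h1]
  · rintro k s' hk1 hk2 ⟨hF, h1, h2, h3⟩ hx
    have hin' : I.HoldsInput s' := hs.frame hF (by decide) (by decide)
    have hex : (∃ x ∈ Finset.Ico (p + 1) (k + 1), I.bendAt x = s.nat 7 0) ↔
        (∃ x ∈ Finset.Ico (p + 1) k, I.bendAt x = s.nat 7 0) ∨ I.bendAt k = s.nat 7 0 := by
      rw [← Finset.insert_Ico_right_eq_Ico_add_one hk1, Finset.exists_mem_insert, or_comm]
    refine .of_exec (by simp [Program.LoopFree]) (by decide) ?_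
    by_cases hC : (Test.conj (.nle (.read 3 (nvar 13)) (nvar 7))
        (.nle (nvar 7) (.read 3 (nvar 13)))).Holds s'
    · rw [Program.exec_branch_true hC, Program.exec_nset]
      simp only [Test.Holds, NExp.val, hx, hin'.bendAt_eq, h7 hF, ← le_antisymm_iff] at hC
      simp only [NExp.val, h11 hF]
      refine ⟨⟨hF.nstore (by decide) _ _, by simpa using h1, fun x hx => ?_, ?_⟩, by simpa using hx⟩
      · simp [hx, h2 x hx]
      · rw [if_pos (hex.2 (Or.inr hC))]
        simp
    · rw [Program.exec_branch_false hC, Program.exec_skip]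
      simp only [Test.Holds, NExp.val, hx, hin'.bendAt_eq, h7 hF, ← le_antisymm_iff] at hC
      refine ⟨⟨hF, h1, h2, ?_⟩, hx⟩
      rw [h3]
      rw [or_iff_left hC] at hex
      by_cases h : ∃ x ∈ Finset.Ico (p + 1) k, I.bendAt x = s.nat 7 0
      · rw [if_pos h, if_pos (hex.2 h)]
      · rw [if_neg h, if_neg (mt hex.1 h)]
  · have h1 : s.nat 5 p - (p + 1) ≤ I.n := by omega
    have h2 := Nat.mul_le_mul h1 (le_refl 44)
    simp only [Program.maxCost, NExp.cost]
    linarith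
  · rintro s' ⟨hF, -, h2, h3⟩
    refine ⟨hF, h2, ?_⟩
    rw [h3, GreedyHitting.discard]
    rcases le_total (p + 1) (s.nat 5 p) with hle | hle
    · rw [max_eq_right hle]
    · rw [max_eq_left hle, Finset.Ico_self, Finset.Ico_eq_empty (by omega)]

theorem ensures_retainBest {s : State} (hs : I.HoldsInput s)
    (hthr : ∀ p < I.lineStart I.ℓ, s.nat 5 p ≤ p + I.n) :
    Ensures retainBest s (200 * (I.ℓ * I.n ^ 2)) fun s' => Frame [4, 5, 8, 11, 13] [] s s' ∧
      (s.nat 6 (s.nat 7 0) = 0 → s'.nat 4 = s.nat 4 ∧ s'.nat 5 = s.nat 5) ∧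
      (s.nat 6 (s.nat 7 0) ≠ 0 →
        (∀ v, s'.nat 4 v = if v = s.nat 7 0 then 1 else s.nat 4 v) ∧
        ∀ p < I.lineStart I.ℓ, s'.nat 5 p = discard I.bendAt (s.nat 5) (s.nat 7 0) p) := by
  have hn1 := I.n_pos
  have hℓ1 := I.ℓ_pos
  set T := I.lineStart I.ℓ with hT
  have hTle : T ≤ I.ℓ * I.n := lineStart_total_le I
  refine Ensures.mono (B := (Test.nle (.read 6 (nvar 7)) (.lit 0)).cost + (20 + T * (120 * I.n)))
    (Ensures.branch ?_ ?_) ?_ fun s' h => h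
  · intro h0
    simp only [Test.Holds, NExp.val, Nat.le_zero] at h0
    refine .of_exec (c := .skip) trivial (by simp only [Program.maxCost]; omega) ?_
    exact ⟨Frame.refl _ _ _, fun _ => ⟨rfl, rfl⟩, fun h => absurd h0 h⟩
  · intro h0
    simp only [Test.Holds, NExp.val, Nat.le_zero] at h0
    have hin : ∀ {s'}, Frame [4, 5, 8, 11, 13] [] s s' → I.HoldsInput s' :=
      fun hF => hs.frame hF (by decide) (by decide)
    refine Ensures.mono (Ensures.seq_exec ?_ (Ensures.forLoop (l := 0) (h := T) (B := 100 * I.n)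
      (fun k s' => Frame [4, 5, 8, 11, 13] [] s s' ∧
        (∀ v, s'.nat 4 v = if v = s.nat 7 0 then 1 else s.nat 4 v) ∧
        (∀ p < k, s'.nat 5 p = discard I.bendAt (s.nat 5) (s.nat 7 0) p) ∧
        ∀ p, k ≤ p → s'.nat 5 p = s.nat 5 p)
      rfl ?_ ?_ ?_ ?_ fun s' h => h)) ?_ ?_
    · trivial
    · rw [Program.exec_nset]
      simp only [NExp.val]
      exact ⟨(Frame.refl _ _ _).nstore (by decide) _ _, by simp, by simp, by simp⟩
    · rintro k s' v ⟨hF, h1, h2, h3⟩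
      exact ⟨hF.nstore (by decide) _ _, by simpa using h1, by simpa using h2, by simpa using h3⟩
    · rintro k s' ⟨hF, -⟩
      exact totalLength_val (hin hF)
    · rintro k s' - hk ⟨hF, h1, h2, h3⟩ hx
      have hk' := h3 k le_rfl
      refine (ensures_discardStep (hin hF) hx (by rw [hk']; exact hthr k hk)).mono le_rfl ?_
      rintro s'' ⟨hF', h1', h2'⟩
      refine ⟨⟨hF.trans (hF'.mono (by decide) (by decide)), ?_, ?_, ?_⟩, ?_⟩
      · rw [hF'.1 4 (by decide)]
        exact h1
      · intro p hp
        rcases Nat.lt_succ_iff_lt_or_eq.1 hp with hp | rfl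
        · rw [h1' p hp.ne, h2 p hp]
        · rw [h2', hF.1 7 (by decide), GreedyHitting.discard, GreedyHitting.discard, hk']
      · intro p hp
        rw [h1' p (by omega), h3 p (by omega)]
      · rw [hF'.1 11 (by decide), hx]
    · simp only [Program.maxCost, NExp.cost, totalLength]
      rw [Nat.sub_zero]
      nlinarith
    · rintro s' ⟨hF, h1, h2, -⟩
      rw [max_eq_right (Nat.zero_le _)] at h2
      exact ⟨hF, fun h => absurd h h0, fun _ => ⟨h1, h2⟩⟩
  · have h1 : T * (120 * I.n) ≤ I.ℓ * I.n * (120 * I.n) := Nat.mul_le_mul hTle le_rfl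
    have h3 : 1 ≤ I.ℓ * I.n ^ 2 := Nat.mul_pos hℓ1 (Nat.pow_pos hn1)
    simp only [Test.cost, NExp.cost]
    nlinarith

end RealRAM

/-! ### The approximation algorithm -/

namespace RealRAM

open PBSInstance GreedyHitting

variable {I : PBSInstance}

theorem ensures_greedyHitting {s : State} (hs : I.HoldsInput s)
    (hthr : ∀ p < I.lineStart I.ℓ, s.nat 5 p ≤ p + I.n) {H : Finset ℕ}
    (hHn : H ⊆ Finset.range I.n)
    (hH : ∀ p < I.lineStart I.ℓ, s.nat 5 p ≠ 0 →
      ∃ x ∈ Finset.Ico (p + 1) (s.nat 5 p), I.bendAt x ∈ H)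
    (hinj : ∀ p < I.lineStart I.ℓ, ∀ x ∈ Finset.Ico (p + 1) (s.nat 5 p),
      ∀ y ∈ Finset.Ico (p + 1) (s.nat 5 p), I.bendAt x = I.bendAt y → x = y) :
    Ensures greedyHitting s (1000 * (I.ℓ * I.n ^ 3)) fun s' =>
      ∃ G : Finset ℕ, (∀ v, s'.nat 4 v ≠ 0 ↔ s.nat 4 v ≠ 0 ∨ v ∈ G) ∧
        Inv I.bendAt (I.lineStart I.ℓ) (s.nat 5) I.n H.card I.n (s'.nat 5) G := by
  have hn1 := I.n_pos
  have hℓ1 := I.ℓ_pos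
  refine Ensures.mono (Ensures.forLoop (l := 0) (h := I.n)
    (B := 200 * (I.ℓ * I.n ^ 2) + (100 * I.n + 200 * (I.ℓ * I.n ^ 2)))
    (fun r s' => Frame [4, 5, 6, 7, 8, 11, 13, 15, 16] [] s s' ∧
      ∃ G : Finset ℕ, (∀ v, s'.nat 4 v ≠ 0 ↔ s.nat 4 v ≠ 0 ∨ v ∈ G) ∧
        Inv I.bendAt (I.lineStart I.ℓ) (s.nat 5) I.n H.card r (s'.nat 5) G)
    rfl ?_ ?_ ?_ ?_ fun s' h => h) ?_ ?_
  · exact ⟨Frame.refl _ _ _, ∅, by simp, Inv.init _⟩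
  · rintro r s' v ⟨hF, G, hG, hI⟩
    refine ⟨hF.nstore (by decide) _ _, G, by simpa using hG, hI.congr ?_⟩
    simp
  · rintro r s' ⟨hF, -⟩
    have hin' : I.HoldsInput s' := hs.frame hF (by decide) (by decide)
    simp only [NExp.val, hin'.n_eq]
  · rintro r s₁ - hr ⟨hF, G, hG, hI⟩ hx
    have hs₁ : I.HoldsInput s₁ := hs.frame hF (by decide) (by decide)
    have hthr₁ : ∀ p < I.lineStart I.ℓ, s₁.nat 5 p ≤ p + I.n := by
      intro p hp
      by_cases h0 : s₁.nat 5 p = 0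
      · omega
      · rw [(hI.unhit p hp h0).1]
        exact hthr p hp
    refine (ensures_countOccurrences hs₁ hthr₁).seq ?_
    rintro s₂ ⟨hF₂, hocc⟩
    have hs₂ : I.HoldsInput s₂ := hs₁.frame hF₂ (by decide) (by decide)
    have h52 : s₂.nat 5 = s₁.nat 5 := hF₂.1 5 (by decide)
    refine (ensures_selectBest hs₂).seq ?_
    rintro s₃ ⟨hF₃, hbn, hbest⟩
    have hs₃ : I.HoldsInput s₃ := hs₂.frame hF₃ (by decide) (by decide)
    have h53 : s₃.nat 5 = s₁.nat 5 := (hF₃.1 5 (by decide)).trans h52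
    have h63 : s₃.nat 6 = s₂.nat 6 := hF₃.1 6 (by decide)
    have h43 : s₃.nat 4 = s₁.nat 4 := (hF₃.1 4 (by decide)).trans (hF₂.1 4 (by decide))
    set b := s₃.nat 7 0 with hb
    have hb' : ∀ v < I.n, occ I.bendAt (I.lineStart I.ℓ) (s₁.nat 5) v ≤
        occ I.bendAt (I.lineStart I.ℓ) (s₁.nat 5) b := by
      intro v hv
      rw [← hocc v hv, ← hocc b hbn, ← h63]
      exact hbest v hv
    refine (ensures_retainBest hs₃ (by rw [h53]; exact hthr₁)).mono le_rfl ?_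
    rintro s₄ ⟨hF₄, hskip, hpick⟩
    rw [← hb, h63, hocc b hbn, h43, h53] at hskip hpick
    refine ⟨⟨((hF.trans (hF₂.mono (by decide) (by decide))).trans
      (hF₃.mono (by decide) (by decide))).trans (hF₄.mono (by decide) (by decide)), ?_⟩, ?_⟩
    · by_cases h0 : occ I.bendAt (I.lineStart I.ℓ) (s₁.nat 5) b = 0
      · obtain ⟨h4, h5⟩ := hskip h0
        rw [h4, h5]
        exact ⟨G, hG, hI.skip hHn hH hb' h0⟩
      · obtain ⟨h4, h5⟩ := hpick h0
        refine ⟨insert b G, fun v => ?_, (hI.pick hHn hH hinj hbn hb' h0).congr h5⟩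
        rw [h4 v, Finset.mem_insert]
        by_cases hvb : v = b
        · simp [hvb]
        · rw [if_neg hvb, hG v]
          simp [hvb]
    · rw [hF₄.1 15 (by decide), hF₃.1 15 (by decide), hF₂.1 15 (by decide), hx]
  · have h1 : 1 ≤ I.ℓ * I.n ^ 3 := Nat.mul_pos hℓ1 (Nat.pow_pos hn1)
    have h2 : I.n ^ 2 ≤ I.ℓ * I.n ^ 3 :=
      (Nat.pow_le_pow_right hn1 (by omega)).trans (Nat.le_mul_of_pos_left _ hℓ1)
    have h3 : I.n ≤ I.n ^ 2 := Nat.le_self_pow (by omega) _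
    simp only [NExp.cost]
    rw [Nat.sub_zero]
    nlinarith
  · rintro s' ⟨hF, G, hG, hI⟩
    rw [max_eq_right (Nat.zero_le _)] at hI
    exact ⟨G, hG, hI⟩

/-- Retains the end points of all polylines. -/
def retainEnds : Program :=
  forLoop 10 (.lit 0) (nvar 1)
    (.seq (.nset 4 (.read 3 (.read 2 (nvar 10))) (.lit 1))
      (.nset 4 (.read 3 (.sub (.read 2 (.add (nvar 10) (.lit 1))) (.lit 1))) (.lit 1)))

/-- The bend `v` is an end point of one of the first `k` polylines. -/
def IsEnd (I : PBSInstance) (k v : ℕ) : Prop :=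
  ∃ i < k, v = I.bendAt (I.lineStart i) ∨ v = I.bendAt (I.lineStart (i + 1) - 1)

theorem ensures_retainEnds {s : State} (hs : I.HoldsInput s) (h4 : ∀ v, s.nat 4 v = 0) :
    Ensures retainEnds s (100 * (I.ℓ * I.n ^ 3)) fun s' => Frame [4, 10] [] s s' ∧
      ∀ v, s'.nat 4 v ≠ 0 ↔ IsEnd I I.ℓ v := by
  have hn1 := I.n_pos
  have hℓ1 := I.ℓ_pos
  refine Ensures.mono (Ensures.forLoop (l := 0) (h := I.ℓ) (B := 30)
    (fun k s' => Frame [4, 10] [] s s' ∧ ∀ v, s'.nat 4 v ≠ 0 ↔ IsEnd I k v)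
    rfl ?_ ?_ ?_ ?_ fun s' h => h) ?_ ?_
  · exact ⟨Frame.refl _ _ _, fun v => by simp [h4 v, IsEnd]⟩
  · rintro k s' v ⟨hF, h⟩
    exact ⟨hF.nstore (by decide) _ _, by simpa using h⟩
  · rintro k s' ⟨hF, -⟩
    have hin' : I.HoldsInput s' := hs.frame hF (by decide) (by decide)
    simp only [NExp.val, hin'.ℓ_eq]
  · rintro k s' - hk ⟨hF, h⟩ hx
    have hin' : I.HoldsInput s' := hs.frame hF (by decide) (by decide)
    refine .of_exec (c := .seq (.nset _ _ _) (.nset _ _ _)) ⟨trivial, trivial⟩ (by decide) ?_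
    rw [Program.exec_seq, Program.exec_nset, Program.exec_nset]
    simp only [NExp.val, hx, hin'.lineStart_eq hk.le, hin'.bendAt_eq]
    have hin'' : I.HoldsInput (s'.nstore 4 (I.bendAt (I.lineStart k)) 1) :=
      hs.frame (hF.nstore (by decide) _ _) (by decide) (by decide)
    have h10 : (s'.nstore 4 (I.bendAt (I.lineStart k)) 1).nat 10 0 = k := by simpa using hx
    rw [h10, hin''.lineStart_eq hk, hin''.bendAt_eq]
    refine ⟨⟨(hF.nstore (by decide) _ _).nstore (by decide) _ _, fun v => ?_⟩, by simpa using hx⟩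
    have hsucc : IsEnd I (k + 1) v ↔ IsEnd I k v ∨ v = I.bendAt (I.lineStart k) ∨
        v = I.bendAt (I.lineStart (k + 1) - 1) := by
      unfold IsEnd
      constructor
      · rintro ⟨i, hi, hv⟩
        rcases Nat.lt_succ_iff_lt_or_eq.1 hi with hi | rfl
        · exact Or.inl ⟨i, hi, hv⟩
        · exact Or.inr hv
      · rintro (⟨i, hi, hv⟩ | hv)
        · exact ⟨i, by omega, hv⟩
        · exact ⟨k, by omega, hv⟩
    rw [hsucc, ← h v]
    simp only [State.nstore_nat, true_and]
    split_ifs with h1 h2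
    · simp [h1]
    · simp [h2]
    · simp [h1, h2]
  · have h3 : I.ℓ ≤ I.ℓ * I.n ^ 3 := Nat.le_mul_of_pos_right _ (Nat.pow_pos hn1)
    simp only [NExp.cost]
    rw [Nat.sub_zero]
    linarith
  · rintro s' ⟨hF, h⟩
    rw [max_eq_right (Nat.zero_le _)] at h
    exact ⟨hF, h⟩

/-- Retains the end points of all polylines and a greedy hitting set of the intervals between the
positions and their first failing partners. -/
def simplifyBundle : Program := .seq retainEnds (.seq thresholds greedyHitting)

end RealRAM

namespace PBSInstance

open RealRAM GreedyHitting

variable (I : PBSInstance)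

theorem head_eq_bendAt (i : Fin I.ℓ) :
    ((I.line i).head (I.line_ne_nil i) : ℕ) = I.bendAt (I.lineStart i) := by
  rw [List.head_eq_getElem]
  exact (I.bendAt_add i (I.length_line_pos i)).symm

theorem getLast_eq_bendAt (i : Fin I.ℓ) :
    ((I.line i).getLast (I.line_ne_nil i) : ℕ) = I.bendAt (I.lineStart (i + 1) - 1) := by
  have hlen := I.length_line_pos i
  rw [List.getLast_eq_getElem, I.lineStart_succ, Nat.add_sub_assoc hlen]
  exact (I.bendAt_add i (by omega)).symm

theorem exists_isSimplification_card_eq_opt :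
    ∃ S : Finset (Fin I.n), I.IsSimplification I.δ S ∧ S.card = I.opt := by
  have huniv : I.IsSimplification I.δ Finset.univ := by
    refine isSimplification_of_isShortcut (by simp) (by simp) fun i p q hp hpq hq hno => ?_
    have hq' : q = p + 1 := by
      by_contra hne
      exact hno ⟨p + 1, by omega, by omega, ⟨I.bendAt (p + 1), I.bendAt_lt i (by omega) (by omega)⟩,
        Finset.mem_univ _, rfl⟩
    rw [hq']
    exact isShortcut_succ I.δ_nonneg p
  exact Nat.sInf_mem
    (s := {k : ℕ | ∃ S : Finset (Fin I.n), I.IsSimplification I.δ S ∧ S.card = k})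
    ⟨_, _, huniv, rfl⟩

/-- The intervals from the positions to their first failing partners are hit by every simplification
with error `δ`, and a set that contains all end points and hits them is a simplification with error
`2 δ`. -/
theorem runs_simplifyBundle : ∃ (t : ℕ) (s : State), Runs simplifyBundle I.input t s ∧
    t ≤ 7000 * (I.ℓ * I.n ^ 3) ∧ I.IsSimplification (2 * I.δ) (I.output s) ∧
    ((I.output s).card : ℝ) ≤ I.opt * (Real.log (I.ℓ * I.n) + 2) := by
  have hin : I.HoldsInput I.input := ⟨fun _ _ => rfl, fun _ _ => rfl⟩
  obtain ⟨O, hO, hOcard⟩ := I.exists_isSimplification_card_eq_opt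
  set T := I.lineStart I.ℓ with hT
  set H : Finset ℕ := O.image Fin.val with hHdef
  have hHcard : H.card = I.opt := by
    rw [hHdef, Finset.card_image_of_injective _ Fin.val_injective, hOcard]
  have hHn : H ⊆ Finset.range I.n := by
    intro v hv
    obtain ⟨w, -, rfl⟩ := Finset.mem_image.1 hv
    exact Finset.mem_range.2 w.isLt
  have hends : ∀ v, IsEnd I I.ℓ v → v ∈ H := by
    rintro v ⟨i, hi, rfl | rfl⟩
    · rw [← I.head_eq_bendAt ⟨i, hi⟩]
      exact Finset.mem_image_of_mem _ (by simpa using (List.mem_filter.1 (hO ⟨i, hi⟩).1).2)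
    · rw [← I.getLast_eq_bendAt ⟨i, hi⟩]
      exact Finset.mem_image_of_mem _ (by simpa using (List.mem_filter.1 (hO ⟨i, hi⟩).2.1).2)
  have hoptpos : 0 < I.opt := by
    rw [← hHcard, Finset.card_pos]
    exact ⟨_, hends _ ⟨0, I.ℓ_pos, Or.inl rfl⟩⟩
  have hTpos : 0 < T := by
    have h1 := I.lineStart_succ ⟨0, I.ℓ_pos⟩
    have h2 := I.length_line_pos ⟨0, I.ℓ_pos⟩
    have h3 := lineStart_mono (I := I) (a := 1) (b := I.ℓ) I.ℓ_pos le_rfl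
    dsimp only at h1
    rw [Nat.zero_add] at h1
    omega
  have hrun : Ensures simplifyBundle I.input (7000 * (I.ℓ * I.n ^ 3)) fun s =>
      ∃ (G : Finset ℕ) (thr₀ thr : ℕ → ℕ), (∀ v, s.nat 4 v ≠ 0 ↔ IsEnd I I.ℓ v ∨ v ∈ G) ∧
        (∀ (i : Fin I.ℓ) (p : ℕ), I.lineStart i ≤ p → p < I.lineStart (i + 1) →
          IsThreshold I (I.lineStart (i + 1)) p (thr₀ p)) ∧
        (∀ p < T, thr₀ p ≠ 0 → ∃ x ∈ Finset.Ico (p + 1) (thr₀ p), I.bendAt x ∈ H) ∧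
        Inv I.bendAt T thr₀ I.n H.card I.n thr G := by
    refine Ensures.mono ((ensures_retainEnds hin fun _ => rfl).seq ?_)
      (show 100 * (I.ℓ * I.n ^ 3) + (5000 * (I.ℓ * I.n ^ 3) + 1000 * (I.ℓ * I.n ^ 3)) ≤ _ by omega)
      fun s h => h
    rintro s₁ ⟨hF₁, h4⟩
    have hs₁ : I.HoldsInput s₁ := hin.frame hF₁ (by decide) (by decide)
    refine (ensures_thresholds hs₁).seq ?_
    rintro s₂ ⟨hF₂, hthr⟩
    have hs₂ : I.HoldsInput s₂ := hs₁.frame hF₂ (by decide) (by decide)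
    have hthr' : ∀ (i : Fin I.ℓ) (p : ℕ), I.lineStart i ≤ p → p < I.lineStart (i + 1) →
        IsThreshold I (I.lineStart (i + 1)) p (s₂.nat 5 p) := fun i p h1 h2 =>
      hthr i p h1 h2 (h2.trans_le (lineStart_mono i.isLt le_rfl))
    have hH : ∀ p < T, s₂.nat 5 p ≠ 0 →
        ∃ x ∈ Finset.Ico (p + 1) (s₂.nat 5 p), I.bendAt x ∈ H := by
      intro p hp h0
      obtain ⟨i, hi1, hi2⟩ := I.exists_line_of_lt le_rfl hp
      rcases hthr' i p hi1 hi2 with h | ⟨h1, h2, h3, -⟩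
      · exact absurd h.1 h0
      · obtain ⟨x, hx1, hx2, v, hv, hvx⟩ := hO.exists_between i hi1 h1 h2 h3
        exact ⟨x, Finset.mem_Ico.2 ⟨hx1, hx2⟩, hvx ▸ Finset.mem_image_of_mem _ hv⟩
    refine (ensures_greedyHitting hs₂ ?_ hHn hH ?_).mono le_rfl ?_
    · intro p hp
      obtain ⟨i, hi1, hi2⟩ := I.exists_line_of_lt le_rfl hp
      have hle := lineStart_succ_le i
      rcases hthr' i p hi1 hi2 with h | h <;> omega
    · intro p hp x hx y hy hxy
      obtain ⟨i, hi1, hi2⟩ := I.exists_line_of_lt le_rfl hp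
      rw [Finset.mem_Ico] at hx hy
      rcases hthr' i p hi1 hi2 with h | h
      · omega
      · exact I.bendAt_inj i (by omega) (by omega) (by omega) (by omega) hxy
    · rintro s₃ ⟨G, hG, hI⟩
      refine ⟨G, s₂.nat 5, s₃.nat 5, fun v => ?_, hthr', hH, hI⟩
      rw [hG v, hF₂.1 4 (by decide), h4 v]
  obtain ⟨t, s, hr, ht, G, thr₀, thr, hout, hthr, hH, hI⟩ := hrun
  have hmem : ∀ v : Fin I.n, v ∈ I.output s ↔ IsEnd I I.ℓ v ∨ (v : ℕ) ∈ G := fun v => by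
    rw [← hout]
    simp [output]
  refine ⟨t, s, hr, ht, isSimplification_of_isShortcut (fun i => ?_) (fun i => ?_) ?_, ?_⟩
  · exact (hmem _).2 (Or.inl ⟨i, i.isLt, Or.inl (I.head_eq_bendAt i)⟩)
  · exact (hmem _).2 (Or.inl ⟨i, i.isLt, Or.inr (I.getLast_eq_bendAt i)⟩)
  · intro i p q hp hpq hq hno
    rcases hthr i p hp (by omega) with ⟨-, h⟩ | ⟨h1, h2, -, h⟩
    · exact h q hpq hq
    · by_cases hqt : q < thr₀ p
      · exact h q hpq hqt
      · have hpT : p < T := (hpq.trans hq).trans_le (lineStart_mono i.isLt le_rfl)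
        obtain ⟨x, hx, hxG⟩ := hI.hit_all hHn hH p hpT (by omega)
        rw [Finset.mem_Ico] at hx
        exact absurd ⟨x, hx.1, by omega, ⟨I.bendAt x, I.bendAt_lt i (by omega) (by omega)⟩,
          (hmem _).2 (Or.inr hxG), rfl⟩ hno
  · have hcard : (I.output s).card ≤ I.opt + G.card := by
      rw [← hHcard, ← Finset.card_image_of_injective (I.output s) Fin.val_injective]
      refine (Finset.card_le_card fun v hv => ?_).trans (Finset.card_union_le H G)
      obtain ⟨w, hw, rfl⟩ := Finset.mem_image.1 hv
      rcases (hmem w).1 hw with h | h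
      · exact Finset.mem_union_left _ (hends _ h)
      · exact Finset.mem_union_right _ h
    have hG := hI.card_le (by rw [hHcard]; exact hoptpos) hTpos
    rw [hHcard] at hG
    have hlog : Real.log T ≤ Real.log (I.ℓ * I.n) := by
      refine Real.log_le_log (by exact_mod_cast hTpos) ?_
      exact_mod_cast lineStart_total_le I
    have hopt1 : (1 : ℝ) ≤ I.opt := by exact_mod_cast hoptpos
    have hcard' : ((I.output s).card : ℝ) ≤ I.opt + G.card := by exact_mod_cast hcard
    nlinarith

end PBSInstance

/-- A bi-criteria `(O(log (ℓ + n)), 2)`-approximation algorithm for polyline bundle simplification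
with running time `O(ℓ n³)`. -/
theorem mainTheorem4 :
    ∃ (prog : RealRAM.Program) (C : ℕ) (K : ℝ), ∀ I : PBSInstance,
      ∃ (t : ℕ) (s : RealRAM.State),
        RealRAM.Runs prog I.input t s ∧
        t ≤ C * (I.ℓ * I.n ^ 3) ∧
        I.IsSimplification (2 * I.δ) (I.output s) ∧
        ((I.output s).card : ℝ) ≤ K * Real.log ((I.ℓ : ℝ) + (I.n : ℝ)) * (I.opt : ℝ) := by
  refine ⟨RealRAM.simplifyBundle, 7000, 6, fun I => ?_⟩
  obtain ⟨t, s, hr, ht, hS, hcard⟩ := I.runs_simplifyBundle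
  refine ⟨t, s, hr, ht, hS, hcard.trans ?_⟩
  have hℓ : (1 : ℝ) ≤ I.ℓ := by exact_mod_cast I.ℓ_pos
  have hn : (1 : ℝ) ≤ I.n := by exact_mod_cast I.n_pos
  have h1 : Real.log (I.ℓ * I.n) ≤ 2 * Real.log ((I.ℓ : ℝ) + I.n) := by
    rw [← Nat.cast_ofNat, ← Real.log_pow]
    exact Real.log_le_log (by positivity) (by nlinarith)
  -- Since `ℓ + n ≥ 2`, additive constants are absorbed by the logarithm.
  have h2 : Real.log 2 ≤ Real.log ((I.ℓ : ℝ) + I.n) := Real.log_le_log (by norm_num) (by linarith)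
  have h3 := Real.log_two_gt_d9
  have h4 : (0 : ℝ) ≤ I.opt := by positivity
  calc (I.opt : ℝ) * (Real.log (I.ℓ * I.n) + 2)
      ≤ I.opt * (6 * Real.log ((I.ℓ : ℝ) + I.n)) := by
        gcongr
        linarith
    _ = 6 * Real.log ((I.ℓ : ℝ) + I.n) * I.opt := by ring
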